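/- All graphs are finite and simple. A \emph{split} of a graph $G$ is a partition $(A,B)$ of $V(G)$ with $|A|,|B|\ge 2$ for which there are $A_0\subseteq A$ and $B_0\subseteq B$ such that a vertex $a\in A$ is adjacent to a vertex $b\in B$ if and only if $a\in A_0$ and $b\in B_0$; a graph is \emph{prime} if it has no split. The \emph{local complementation} $G*v$ of $G$ at a vertex $v$ is obtained from $G$ by replacing the subgraph induced on the neighbors of $v$ by its complement. A \emph{vertex-minor} of $G$ is an induced subgraph of a graph $G*v_1*v_2*\cdots*v_n$ for some sequence $v_1,\dots,v_n$ ($n\ge 0$) of not necessarily distinct vertices of $G$. Let $P_c$ denote the path on $c$ vertices, and let $K_c\boxdot K_c$ denote the graph on $2c$ vertices obtained from two disjoint copies of the complete graph $K_c$ by adding the perfect matching that joins the two copies of each vertex. For every $c$ there exists $N$ such that every prime graph on at least $N$ vertices has a vertex-minor isomorphic to either $P_c$ or $K_c\boxdot K_c$. -/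

import Mathlib

namespace SimpleGraph

/-- The local complementation `G * v`: the adjacency of every pair of distinct neighbors of `v`
is flipped, and all other adjacencies are kept. -/
def localComplement {V : Type*} (G : SimpleGraph V) (v : V) : SimpleGraph V where
  Adj x y := x ≠ y ∧ Xor (G.Adj x y) (G.Adj v x ∧ G.Adj v y)
  symm := ⟨fun x y h => by
    rw [G.adj_comm y x, and_comm (a := G.Adj v y)]
    exact ⟨h.1.symm, h.2⟩⟩
  loopless := ⟨fun _ h => h.1 rfl⟩

/-- `G'` is locally equivalent to `G`: for some finite sequence `v₁, …, vₙ` of (not necessarily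
distinct) vertices, `G' = G * v₁ * v₂ * ⋯ * vₙ`. -/
def LocallyEquivalent {V : Type*} (G G' : SimpleGraph V) : Prop :=
  ∃ l : List V, G' = l.foldl localComplement G

/-- `G` has a vertex-minor isomorphic to `H`: some graph locally equivalent to `G` has an induced
subgraph isomorphic to `H`. -/
def HasVertexMinorIso {V W : Type*} (G : SimpleGraph V) (H : SimpleGraph W) : Prop :=
  ∃ G' : SimpleGraph V, G.LocallyEquivalent G' ∧ ∃ S : Set V, Nonempty (H ≃g G'.induce S)

/-- `(A, B)` is a split of `G`: a partition of the vertex set into two parts with at least two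
vertices each, such that for some `A₀ ⊆ A` and `B₀ ⊆ B`, a vertex `a ∈ A` is adjacent to a vertex
`b ∈ B` exactly when `a ∈ A₀` and `b ∈ B₀`. -/
def IsSplit {V : Type*} (G : SimpleGraph V) (A B : Set V) : Prop :=
  Disjoint A B ∧ A ∪ B = Set.univ ∧ A.Nontrivial ∧ B.Nontrivial ∧
    ∃ A₀ ⊆ A, ∃ B₀ ⊆ B, ∀ a ∈ A, ∀ b ∈ B, G.Adj a b ↔ a ∈ A₀ ∧ b ∈ B₀

/-- A graph is prime (with respect to split decomposition) if it has no split. -/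
def IsSplitPrime {V : Type*} (G : SimpleGraph V) : Prop :=
  ∀ A B : Set V, ¬ G.IsSplit A B

/-- The graph `G ⊡ H` obtained from the disjoint union of two graphs on the same vertex set by
adding the perfect matching that joins the two copies of each vertex. -/
def matchingJoin {V : Type*} (G H : SimpleGraph V) : SimpleGraph (V ⊕ V) where
  Adj
    | .inl a, .inl b => G.Adj a b
    | .inr a, .inr b => H.Adj a b
    | .inl a, .inr b => a = b
    | .inr a, .inl b => a = b
  symm := ⟨by
    rintro (a | a) (b | b) h
    · exact G.adj_symm h
    · exact Eq.symm h
    · exact Eq.symm h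
    · exact H.adj_symm h⟩
  loopless := ⟨by
    rintro (a | a) h
    · exact G.irrefl h
    · exact H.irrefl h⟩

end SimpleGraph

/-! Suppose that `G` is prime, large, and avoids both vertex-minors. The plan is to find, in graphs
locally equivalent to `G`, brooms with longer and longer handles. A handle is an induced path, so a
long one is a contradiction. The induction on the handle length is `exists_hasBroom`, and each round
trades width for length. A large connected graph has a vertex of large degree, and Ramsey's theorem
turns its neighbors into the leaves of a first broom with single-vertex fibers.

Fibers grow one vertex at a time, at the cost of width (`exists_fibers_card_succ`). Since a fiber is
not one side of a split, some outside vertex is attached to it nontrivially; Ramsey's theorem makes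
these attachments uniform (`IsAttached`). A half-graph pattern yields a long path
(`false_of_halfGraph`). If the attached vertices copy the center on all other fibers, a pivot
removes those adjacencies (`IsAttached.exists_pivot`). What remains either lets each fiber absorb
its attached vertex, or exhibits two vertices linked by many mutually nonadjacent connected sets,
which contract to two matched cliques (`false_of_linkedBy`).

One very large fiber then yields a longer handle with many new leaves (`exists_longer_handle`): it
contains a vertex of large degree, and either its neighbors are also neighbors of the center, or a
shortest path from the center towards it prolongs the handle. -/

namespace SimpleGraph

universe u

variable {V : Type u}

/-! ### Local complementation, pivoting, and invariance of primeness -/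

theorem localComplement_adj {G : SimpleGraph V} {v x y : V} (h : x ≠ y) :
    (G.localComplement v).Adj x y ↔ (G.Adj x y ↔ ¬(G.Adj v x ∧ G.Adj v y)) := by
  simp only [localComplement, Xor, ne_eq, h, not_false_eq_true, true_and]
  tauto

theorem localComplement_adj_self {G : SimpleGraph V} {v x : V} :
    (G.localComplement v).Adj v x ↔ G.Adj v x := by
  by_cases h : v = x
  · subst h; simp
  · rw [localComplement_adj h]; simp

theorem localComplement_adj_self' {G : SimpleGraph V} {v x : V} :
    (G.localComplement v).Adj x v ↔ G.Adj x v := by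
  rw [adj_comm, localComplement_adj_self, adj_comm]

theorem localComplement_adj_of_not {G : SimpleGraph V} {v x y : V} (h : ¬ G.Adj v x) :
    (G.localComplement v).Adj x y ↔ G.Adj x y := by
  by_cases h' : x = y
  · subst h'; simp
  · rw [localComplement_adj h']; tauto

theorem localComplement_adj_of_not' {G : SimpleGraph V} {v x y : V} (h : ¬ G.Adj v y) :
    (G.localComplement v).Adj x y ↔ G.Adj x y := by
  rw [adj_comm, localComplement_adj_of_not h, adj_comm]

theorem LocallyEquivalent.refl (G : SimpleGraph V) : G.LocallyEquivalent G := ⟨[], rfl⟩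

theorem LocallyEquivalent.trans {G H K : SimpleGraph V} (h : G.LocallyEquivalent H)
    (h' : H.LocallyEquivalent K) : G.LocallyEquivalent K := by
  obtain ⟨l, rfl⟩ := h
  obtain ⟨m, rfl⟩ := h'
  exact ⟨l ++ m, by simp⟩

theorem LocallyEquivalent.localComplement {G H : SimpleGraph V} (h : G.LocallyEquivalent H)
    (v : V) : G.LocallyEquivalent (H.localComplement v) :=
  h.trans ⟨[v], rfl⟩

theorem locallyEquivalent_localComplement (G : SimpleGraph V) (v : V) :
    G.LocallyEquivalent (G.localComplement v) := ⟨[v], rfl⟩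

/-- Pivoting on the edge `zx` without exchanging the names of its two ends. -/
def pivot (G : SimpleGraph V) (z x : V) : SimpleGraph V :=
  ((G.localComplement z).localComplement x).localComplement z

theorem locallyEquivalent_pivot (G : SimpleGraph V) (z x : V) :
    G.LocallyEquivalent (G.pivot z x) :=
  ((locallyEquivalent_localComplement G z).localComplement x).localComplement z

/-- This is the principal pivot of the adjacency matrix over GF(2) on the rows `z`, `x`: the entry
`ab` changes by `za * xb + xa * zb`. In the applications most vertices miss `z` or `x`, so few terms
survive. -/
theorem pivot_adj {G : SimpleGraph V} {z x a b : V} (h : G.Adj z x) (haz : a ≠ z) (hax : a ≠ x)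
    (hbz : b ≠ z) (hbx : b ≠ x) (hab : a ≠ b) :
    (G.pivot z x).Adj a b ↔
      (G.Adj a b ↔ ((G.Adj z a ∧ G.Adj x b) ↔ (G.Adj x a ∧ G.Adj z b))) := by
  have hzx := h.ne
  have h1 : G.Adj x z := h.symm
  simp only [pivot, localComplement_adj hab, localComplement_adj hax.symm,
    localComplement_adj hbx.symm, localComplement_adj haz.symm, localComplement_adj hbz.symm,
    localComplement_adj_self', h, h1, G.irrefl]
  by_cases h2 : G.Adj z a <;> by_cases h3 : G.Adj z b <;> by_cases h4 : G.Adj x a <;>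
    by_cases h5 : G.Adj x b <;> by_cases h6 : G.Adj a b <;> simp [h2, h3, h4, h5, h6]

theorem pivot_adj_left {G : SimpleGraph V} {z x a : V} (h : G.Adj z x) (haz : a ≠ z)
    (hax : a ≠ x) : (G.pivot z x).Adj z a ↔ G.Adj x a := by
  have hzx := h.ne
  have h1 : G.Adj x z := h.symm
  simp only [pivot, localComplement_adj hax.symm,
    localComplement_adj haz.symm, localComplement_adj_self', h, h1, G.irrefl]
  by_cases h2 : G.Adj z a <;> by_cases h4 : G.Adj x a <;> simp [h2, h4]

theorem pivot_adj_right {G : SimpleGraph V} {z x a : V} (h : G.Adj z x) (haz : a ≠ z)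
    (hax : a ≠ x) : (G.pivot z x).Adj x a ↔ G.Adj z a := by
  have hzx := h.ne
  have h1 : G.Adj x z := h.symm
  simp only [pivot, localComplement_adj hax.symm,
    localComplement_adj haz.symm, localComplement_adj_self, localComplement_adj_self', h, h1,
    G.irrefl]
  by_cases h2 : G.Adj z a <;> by_cases h4 : G.Adj x a <;> simp [h2, h4]

theorem pivot_adj_pair {G : SimpleGraph V} {z x : V} (h : G.Adj z x) : (G.pivot z x).Adj z x := by
  simp only [pivot, localComplement_adj_self, localComplement_adj_self']; exact h

/-- Seen from `B`, every vertex of `A` has neighborhood empty or `B₀`. Complementing at `v ∈ A₀`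
adds `B₀` modulo 2 to the neighborhoods of the neighbors of `v` in `A`, which only toggles their
membership in `A₀`. -/
theorem IsSplit.localComplement_left {G : SimpleGraph V} {A B : Set V} (h : G.IsSplit A B) {v : V}
    (hv : v ∈ A) : (G.localComplement v).IsSplit A B := by
  obtain ⟨h1, h2, h3, h4, A₀, hA, B₀, hB, h5⟩ := h
  refine ⟨h1, h2, h3, h4, {a | a ∈ A ∧ (a ∈ A₀ ↔ ¬ (v ∈ A₀ ∧ G.Adj v a))}, fun a ha => ha.1, B₀, hB,
    fun a ha b hb => ?_⟩
  have hab : a ≠ b := fun h => Set.disjoint_left.1 h1 ha (h ▸ hb)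
  rw [localComplement_adj hab, h5 a ha b hb, h5 v hv b hb]
  simp only [Set.mem_ofPred_eq]
  tauto

theorem IsSplit.symm {G : SimpleGraph V} {A B : Set V} (h : G.IsSplit A B) : G.IsSplit B A := by
  obtain ⟨h1, h2, h3, h4, A₀, hA, B₀, hB, h5⟩ := h
  refine ⟨h1.symm, by rwa [Set.union_comm], h4, h3, B₀, hB, A₀, hA, fun a ha b hb => ?_⟩
  rw [G.adj_comm, h5 b hb a ha, and_comm]

theorem IsSplit.localComplement {G : SimpleGraph V} {A B : Set V} (h : G.IsSplit A B) (v : V) :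
    (G.localComplement v).IsSplit A B := by
  have : v ∈ A ∪ B := by rw [h.2.1]; trivial
  rcases this with hv | hv
  · exact h.localComplement_left hv
  · exact (h.symm.localComplement_left hv).symm

theorem localComplement_localComplement (G : SimpleGraph V) (v : V) :
    (G.localComplement v).localComplement v = G := by
  ext x y
  by_cases hxy : x = y
  · subst hxy; simp
  · rw [localComplement_adj hxy, localComplement_adj hxy, localComplement_adj_self,
      localComplement_adj_self]
    tauto

theorem IsSplitPrime.localComplement {G : SimpleGraph V} (h : G.IsSplitPrime) (v : V) :
    (G.localComplement v).IsSplitPrime := fun A B hs => h A B (by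
  simpa [localComplement_localComplement] using hs.localComplement v)

theorem IsSplitPrime.of_locallyEquivalent {G H : SimpleGraph V} (h : G.IsSplitPrime)
    (hGH : G.LocallyEquivalent H) : H.IsSplitPrime := by
  obtain ⟨l, rfl⟩ := hGH
  induction l generalizing G with
  | nil => exact h
  | cons v l ih => exact ih (h.localComplement v)

/-! ### Excluded vertex-minors and induced paths -/

/-- `G` has neither the path on `c` vertices nor two matched cliques of size `c` as a
vertex-minor. -/
def AvoidsPathAndMatchedCliques (G : SimpleGraph V) (c : ℕ) : Prop :=
  ¬ G.HasVertexMinorIso (pathGraph c) ∧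
    ¬ G.HasVertexMinorIso (matchingJoin (⊤ : SimpleGraph (Fin c)) (⊤ : SimpleGraph (Fin c)))

theorem HasVertexMinorIso.of_locallyEquivalent {W : Type*} {G G' : SimpleGraph V}
    {H : SimpleGraph W} (h : G'.HasVertexMinorIso H) (hG : G.LocallyEquivalent G') :
    G.HasVertexMinorIso H := by
  obtain ⟨K, hK, S, hS⟩ := h
  exact ⟨K, hG.trans hK, S, hS⟩

theorem hasVertexMinorIso_of_injective {W : Type*} {G : SimpleGraph V}
    {H : SimpleGraph W} {f : W → V} (hf : Function.Injective f)
    (h : ∀ i j, G.Adj (f i) (f j) ↔ H.Adj i j) : G.HasVertexMinorIso H :=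
  let e : H ↪g G := ⟨⟨f, hf⟩, fun {i j} => h i j⟩
  ⟨G, .refl G, Set.range e, ⟨e.isoInduceRange⟩⟩

theorem AvoidsPathAndMatchedCliques.of_locallyEquivalent {G G' : SimpleGraph V} {c : ℕ}
    (h : G.AvoidsPathAndMatchedCliques c) (hG : G.LocallyEquivalent G') :
    G'.AvoidsPathAndMatchedCliques c :=
  ⟨fun h' => h.1 (h'.of_locallyEquivalent hG), fun h' => h.2 (h'.of_locallyEquivalent hG)⟩

/-- The vertices of the list `l` form, in this order, an induced path of `G`. -/
def IsInducedPathList (G : SimpleGraph V) : List V → Prop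
  | [] => True
  | [_] => True
  | x :: y :: l => G.Adj x y ∧ (∀ u ∈ l, ¬ G.Adj x u ∧ u ≠ x) ∧ IsInducedPathList G (y :: l)

theorem IsInducedPathList.tail {G : SimpleGraph V} {x : V} {l : List V}
    (h : G.IsInducedPathList (x :: l)) : G.IsInducedPathList l := by
  cases l with
  | nil => trivial
  | cons y l => exact h.2.2

theorem IsInducedPathList.head_ne {G : SimpleGraph V} {x : V} {l : List V}
    (h : G.IsInducedPathList (x :: l)) : ∀ u ∈ l, u ≠ x := by
  cases l with
  | nil => simp
  | cons y l =>
    intro u hu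
    rcases List.mem_cons.1 hu with rfl | hu
    · exact h.1.ne'
    · exact (h.2.1 u hu).2

theorem IsInducedPathList.adj_iff {G : SimpleGraph V} {l : List V} (h : G.IsInducedPathList l) :
    ∀ (i j : ℕ) (hij : i < j) (hj : j < l.length), l[i] ≠ l[j] ∧
      (G.Adj (l[i]'(hij.trans hj)) l[j] ↔ i + 1 = j) := by
  induction l with
  | nil => intro i j _ hj; simp at hj
  | cons x l ih =>
    intro i j hij hj
    obtain ⟨j, rfl⟩ : ∃ k, j = k + 1 := ⟨j - 1, by omega⟩
    have hj' : j < l.length := by simpa using hj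
    rcases i with _ | i
    · refine ⟨(h.head_ne _ (by simp)).symm, ?_⟩
      cases l with
      | nil => simp at hj'
      | cons y l =>
        rcases j with _ | j
        · simpa using h.1
        · simpa using (h.2.1 (l[j]'(by simpa using hj')) (by simp)).1
    · simpa using ih h.tail i j (by omega) hj'

theorem IsInducedPathList.length_lt {G : SimpleGraph V} {l : List V} (h : G.IsInducedPathList l)
    {c : ℕ} (hG : G.AvoidsPathAndMatchedCliques c) : l.length < c := by
  by_contra! hc
  apply hG.1
  refine hasVertexMinorIso_of_injective (f := fun i : Fin c => l[i.1]'(i.2.trans_le hc))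
    (fun i j hij => ?_) (fun i j => ?_)
  · by_contra hne
    rcases lt_or_gt_of_ne (fun h => hne (Fin.ext h)) with hlt | hlt
    · exact (h.adj_iff _ _ hlt (j.2.trans_le hc)).1 hij
    · exact (h.adj_iff _ _ hlt (i.2.trans_le hc)).1 hij.symm
  · simp only [pathGraph_adj]
    rcases lt_trichotomy i.1 j.1 with hlt | heq | hlt
    · rw [(h.adj_iff _ _ hlt (j.2.trans_le hc)).2]; omega
    · rw [Fin.ext heq]; simp
    · rw [G.adj_comm, (h.adj_iff _ _ hlt (i.2.trans_le hc)).2]; omega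

/-- The list `s n, …, s 0` followed by `l`. -/
def prependRev (s : ℕ → V) : ℕ → List V → List V
  | 0, l => s 0 :: l
  | n + 1, l => s (n + 1) :: prependRev s n l

theorem length_prependRev (s : ℕ → V) (n : ℕ) (l : List V) :
    (prependRev s n l).length = n + 1 + l.length := by
  induction n with
  | zero => simp [prependRev]; omega
  | succ n ih => simp [prependRev, ih]; omega

theorem mem_prependRev {s : ℕ → V} {n : ℕ} {l : List V} {u : V} :
    u ∈ prependRev s n l ↔ u ∈ l ∨ ∃ i ≤ n, s i = u := by
  induction n with
  | zero => simp [prependRev, eq_comm, or_comm]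
  | succ n ih =>
    simp only [prependRev, List.mem_cons, ih]
    constructor
    · rintro (rfl | h | ⟨i, hi, rfl⟩)
      · exact .inr ⟨_, le_rfl, rfl⟩
      · exact .inl h
      · exact .inr ⟨i, by omega, rfl⟩
    · rintro (h | ⟨i, hi, rfl⟩)
      · exact .inr (.inl h)
      · rcases Nat.lt_or_ge n i with hlt | hle
        · obtain rfl : i = n + 1 := by omega
          exact .inl rfl
        · exact .inr (.inr ⟨i, hle, rfl⟩)

theorem prependRev_eq_cons (s : ℕ → V) (n : ℕ) (l : List V) :
    ∃ t, prependRev s n l = s n :: t ∧ ∀ u, u ∈ t ↔ u ∈ l ∨ ∃ i < n, s i = u := by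
  cases n with
  | zero => exact ⟨l, rfl, by simp⟩
  | succ n => exact ⟨_, rfl, fun u => by simp [mem_prependRev]⟩

/-- `s 0, …, s n` is an induced path of `G`. -/
def IsInducedPathSeq (G : SimpleGraph V) (s : ℕ → V) (n : ℕ) : Prop :=
  ∀ i j, i < j → j ≤ n → s i ≠ s j ∧ (G.Adj (s i) (s j) ↔ i + 1 = j)

theorem IsInducedPathSeq.mono {G : SimpleGraph V} {s : ℕ → V} {n m : ℕ}
    (h : G.IsInducedPathSeq s n) (hm : m ≤ n) : G.IsInducedPathSeq s m :=
  fun i j hij hj => h i j hij (hj.trans hm)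

/-- This lengthens a handle `z :: l` by a path that starts at a neighbor of `z` and leads into a
fiber; the far end `s n` becomes the new head, hence the reversed order. -/
theorem IsInducedPathSeq.cons_prependRev {G : SimpleGraph V} {s : ℕ → V} {n : ℕ} {z : V}
    {l : List V} (h : G.IsInducedPathSeq s n) (hl : G.IsInducedPathList (z :: l))
    (hz : ∀ i ≤ n, s i ≠ z ∧ (G.Adj (s i) z ↔ i = 0))
    (hl' : ∀ i ≤ n, ∀ u ∈ l, s i ≠ u ∧ ¬ G.Adj (s i) u) :
    G.IsInducedPathList (prependRev s n (z :: l)) := by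
  induction n with
  | zero =>
    exact ⟨((hz 0 le_rfl).2.2 rfl), fun u hu => ⟨(hl' 0 le_rfl u hu).2, (hl' 0 le_rfl u hu).1.symm⟩,
      hl⟩
  | succ n ih =>
    have ih' := ih (h.mono (by omega)) (fun i hi => hz i (by omega)) (fun i hi => hl' i (by omega))
    obtain ⟨t, ht, ht'⟩ := prependRev_eq_cons s n (z :: l)
    rw [prependRev, ht]
    rw [ht] at ih'
    refine ⟨((h n (n + 1) (by omega) le_rfl).2.2 rfl).symm, fun u hu => ?_, ih'⟩
    rcases (ht' u).1 hu with hu | ⟨i, hi, rfl⟩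
    · rcases List.mem_cons.1 hu with rfl | hu
      · have := hz (n + 1) le_rfl
        exact ⟨fun h => by simpa using this.2.1 h, this.1.symm⟩
      · exact ⟨(hl' _ le_rfl u hu).2, (hl' _ le_rfl u hu).1.symm⟩
    · have := h i (n + 1) (by omega) le_rfl
      exact ⟨fun h => by have := this.2.1 h.symm; omega, this.1⟩

theorem IsInducedPathSeq.prependRev_nil {G : SimpleGraph V} {s : ℕ → V} {n : ℕ}
    (h : G.IsInducedPathSeq s n) : G.IsInducedPathList (prependRev s n []) := by
  induction n with
  | zero => trivial
  | succ n ih =>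
    have ih' := ih (h.mono (by omega))
    obtain ⟨t, ht, ht'⟩ := prependRev_eq_cons s n []
    rw [prependRev, ht]
    rw [ht] at ih'
    refine ⟨((h n (n + 1) (by omega) le_rfl).2.2 rfl).symm, fun u hu => ?_, ih'⟩
    obtain ⟨i, hi, rfl⟩ : ∃ i < n, s i = u := by simpa using (ht' u).1 hu
    have := h i (n + 1) (by omega) le_rfl
    exact ⟨fun h => by have := this.2.1 h.symm; omega, this.1⟩

theorem IsInducedPathSeq.lt {G : SimpleGraph V} {s : ℕ → V} {n c : ℕ}
    (h : G.IsInducedPathSeq s n) (hG : G.AvoidsPathAndMatchedCliques c) : n + 1 < c := by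
  simpa [length_prependRev] using h.prependRev_nil.length_lt hG

end SimpleGraph

/-! ### Ramsey and pigeonhole for sequences -/

/-- The first half of Ramsey's theorem: take the minimum of `X`, pass to a largest color class among
the later elements, and repeat. Pigeonhole on the colors `k` finishes the argument in
`exists_homogeneous_subsequence`. -/
theorem exists_endHomogeneous (K : Type*) [Finite K] (n : ℕ) :
    ∃ N, ∀ (f : ℕ → ℕ → K) (X : Finset ℕ), N ≤ X.card →
      ∃ H ⊆ X, H.card = n ∧ ∀ a ∈ H, ∃ k, ∀ b ∈ H, a < b → f a b = k := by
  classical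
  have := Fintype.ofFinite K
  induction n with
  | zero => exact ⟨0, fun f X _ => ⟨∅, by simp⟩⟩
  | succ n ih =>
    obtain ⟨N, hN⟩ := ih
    refine ⟨Fintype.card K * N + 2, fun f X hX => ?_⟩
    have hne : X.Nonempty := Finset.card_pos.1 (by omega)
    set m := X.min' hne
    have hcard : (Finset.univ : Finset K).card * N < (X.erase m).card := by
      rw [Finset.card_erase_of_mem (X.min'_mem hne), Finset.card_univ]; omega
    obtain ⟨k, -, hk⟩ := Finset.exists_lt_card_fiber_of_mul_lt_card_of_maps_to
      (f := fun b => f m b) (fun b _ => Finset.mem_univ _) hcard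
    obtain ⟨H, hH, hc, hh⟩ := hN f _ hk.le
    have hlt : ∀ b ∈ H, m < b ∧ f m b = k ∧ b ∈ X := fun b hb => by
      have h1 := Finset.mem_filter.1 (hH hb)
      have h2 := Finset.mem_erase.1 h1.1
      exact ⟨lt_of_le_of_ne (X.min'_le b h2.2) h2.1.symm, h1.2, h2.2⟩
    have hm : m ∉ H := fun h => (hlt m h).1.false
    refine ⟨insert m H, fun b hb => ?_, by rw [Finset.card_insert_of_notMem hm, hc], ?_⟩
    · rcases Finset.mem_insert.1 hb with rfl | hb
      · exact X.min'_mem hne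
      · exact (hlt b hb).2.2
    · intro a ha
      rcases Finset.mem_insert.1 ha with rfl | ha
      · refine ⟨k, fun b hb hab => ?_⟩
        rcases Finset.mem_insert.1 hb with rfl | hb
        · exact (hab.false).elim
        · exact (hlt b hb).2.1
      · obtain ⟨k', hk'⟩ := hh a ha
        refine ⟨k', fun b hb hab => ?_⟩
        rcases Finset.mem_insert.1 hb with rfl | hb
        · exact ((hlt a ha).1.trans hab).false.elim
        · exact hk' b hb hab

theorem Finset.exists_strictMono_nat (s : Finset ℕ) :
    ∃ g : ℕ → ℕ, (∀ i j, i < j → j < s.card → g i < g j) ∧ ∀ i < s.card, g i ∈ s := by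
  classical
  refine ⟨fun i => if h : i < s.card then s.orderEmbOfFin rfl ⟨i, h⟩ else 0, ?_, ?_⟩
  · intro i j hij hj
    simp [hj, hij.trans hj, hij]
  · intro i hi
    simp only [hi, dite_true]
    exact s.orderEmbOfFin_mem rfl _

/-- Pigeonhole principle for sequences. -/
theorem exists_subsequence_of_finite (K : Type*) [Finite K] (n : ℕ) :
    ∃ N, ∀ f : ℕ → K, ∃ g : ℕ → ℕ, (∀ i j, i < j → j < n → g i < g j) ∧ (∀ i < n, g i < N) ∧
      ∃ k, ∀ i < n, f (g i) = k := by
  classical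
  have := Fintype.ofFinite K
  refine ⟨Fintype.card K * n + 1, fun f => ?_⟩
  obtain ⟨k, -, hk⟩ := Finset.exists_lt_card_fiber_of_mul_lt_card_of_maps_to
    (s := Finset.range (Fintype.card K * n + 1)) (t := (Finset.univ : Finset K)) (n := n)
    (f := f) (fun b _ => Finset.mem_univ _) (by simp)
  obtain ⟨g, hg, hg'⟩ := Finset.exists_strictMono_nat
    {x ∈ Finset.range (Fintype.card K * n + 1) | f x = k}
  refine ⟨g, fun i j hij hj => hg i j hij (by omega), fun i hi => ?_, k, fun i hi => ?_⟩
  · have := Finset.mem_filter.1 (hg' i (by omega)); simpa using this.1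
  · exact (Finset.mem_filter.1 (hg' i (by omega))).2

/-- Ramsey's theorem for pairs. -/
theorem exists_homogeneous_subsequence (K : Type*) [Finite K] (n : ℕ) :
    ∃ N, ∀ f : ℕ → ℕ → K, ∃ g : ℕ → ℕ, (∀ i j, i < j → j < n → g i < g j) ∧
      (∀ i < n, g i < N) ∧ ∃ k, ∀ i j, i < j → j < n → f (g i) (g j) = k := by
  classical
  obtain ⟨M, hM⟩ := exists_subsequence_of_finite K n
  obtain ⟨N, hN⟩ := exists_endHomogeneous K M
  refine ⟨N, fun f => ?_⟩
  obtain ⟨H, hH, hc, hh⟩ := hN f (Finset.range N) (by simp)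
  obtain ⟨g, hg, hg'⟩ := H.exists_strictMono_nat
  choose φ hφ using fun a : ℕ => show ∃ k : K, a ∈ H → ∀ b ∈ H, a < b → f a b = k by
    by_cases ha : a ∈ H
    · exact (hh a ha).imp fun k hk _ => hk
    -- Outside `H` the color is irrelevant; `f 0 0` only provides an element of `K`.
    · exact ⟨f 0 0, fun h => (ha h).elim⟩
  obtain ⟨g', hg1, hg2, k, hk⟩ := hM (fun i => φ (g i))
  refine ⟨g ∘ g', fun i j hij hj => hg _ _ (hg1 i j hij hj) (hc ▸ hg2 j hj), fun i hi => ?_, k,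
    fun i j hij hj => ?_⟩
  · simpa using hH (hg' (g' i) (hc ▸ hg2 i hi))
  · have h1 := hg' (g' i) (hc ▸ hg2 i (hij.trans hj))
    have h2 := hg' (g' j) (hc ▸ hg2 j hj)
    rw [← hk i (hij.trans hj)]
    exact hφ _ h1 _ h2 (hg _ _ (hg1 i j hij hj) (hc ▸ hg2 j hj))

namespace SimpleGraph

universe u

variable {V : Type u}

/-! ### Connected sets, shortest paths, and large degree -/

/-- The subgraph induced on `F` is connected: every proper nonempty part of `F` sends an edge to
the rest of `F`. -/
def ConnectedOn (G : SimpleGraph V) (F : Set V) : Prop :=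
  ∀ X ⊆ F, X.Nonempty → X ≠ F → ∃ x ∈ X, ∃ y ∈ F, y ∉ X ∧ G.Adj x y

theorem ConnectedOn.congr {G G' : SimpleGraph V} {F : Set V} (h : G.ConnectedOn F)
    (hG : ∀ a ∈ F, ∀ b ∈ F, G.Adj a b → G'.Adj a b) : G'.ConnectedOn F := fun X hX h1 h2 => by
  obtain ⟨x, hx, y, hy, hyX, hxy⟩ := h X hX h1 h2
  exact ⟨x, hx, y, hy, hyX, hG x (hX hx) y hy hxy⟩

theorem ConnectedOn.insert {G : SimpleGraph V} {F : Set V} (h : G.ConnectedOn F) {v x : V}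
    (hx : x ∈ F) (hv : G.Adj v x) : G.ConnectedOn (insert v F) := by
  intro X hX h1 h2
  by_cases h3 : X ∩ F = F
  · have hFX : F ⊆ X := Set.inter_eq_right.1 h3
    have hvX : v ∉ X := fun hvX => h2 (hX.antisymm (Set.insert_subset hvX hFX))
    exact ⟨x, hFX hx, v, Set.mem_insert _ _, hvX, hv.symm⟩
  by_cases h4 : (X ∩ F).Nonempty
  · obtain ⟨a, ha, b, hb, hbX, hab⟩ := h _ Set.inter_subset_right h4 h3
    exact ⟨a, ha.1, b, Set.mem_insert_of_mem _ hb, fun h => hbX ⟨h, hb⟩, hab⟩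
  · have hvX : v ∈ X := by
      obtain ⟨a, ha⟩ := h1
      rcases hX ha with rfl | haF
      · exact ha
      · exact (h4 ⟨a, ha, haF⟩).elim
    exact ⟨v, hvX, x, Set.mem_insert_of_mem _ hx, fun h => h4 ⟨x, h, hx⟩, hv⟩

theorem connectedOn_singleton (G : SimpleGraph V) (x : V) : G.ConnectedOn {x} :=
  fun _ hX h1 h2 => (h2 ((Set.subset_singleton_iff_eq.1 hX).resolve_left h1.ne_empty)).elim

/-- The vertices reached from `A` by walks of length `k` within `F`. -/
def walkLayer (G : SimpleGraph V) (F A : Set V) : ℕ → Set V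
  | 0 => A
  | k + 1 => {u | u ∈ F ∧ ∃ w ∈ walkLayer G F A k, G.Adj w u}

theorem walkLayer_subset {G : SimpleGraph V} {F A : Set V} (hA : A ⊆ F) (k : ℕ) :
    G.walkLayer F A k ⊆ F := by
  cases k with
  | zero => exact hA
  | succ k => exact fun u hu => hu.1

theorem ConnectedOn.exists_mem_walkLayer {G : SimpleGraph V} {F A : Set V} (h : G.ConnectedOn F)
    (hA : A ⊆ F) (hA' : A.Nonempty) {u : V} (hu : u ∈ F) : ∃ k, u ∈ G.walkLayer F A k := by
  by_contra! hcon
  obtain ⟨x, ⟨hx, k, hk⟩, y, hy, hyX, hxy⟩ := h {u | u ∈ F ∧ ∃ k, u ∈ G.walkLayer F A k}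
    (fun u hu => hu.1) (hA'.imp fun a ha => ⟨hA ha, 0, ha⟩)
    (fun h => by
      obtain ⟨k, hk⟩ := (Set.ext_iff.1 h u).2 hu |>.2
      exact hcon k hk)
  exact hyX ⟨hy, k + 1, hy, x, hk, hxy⟩

/-- A shortest path within `F` from `A` to `B`. -/
theorem ConnectedOn.exists_isInducedPathSeq {G : SimpleGraph V} {F A B : Set V}
    (h : G.ConnectedOn F) (hA : A ⊆ F) (hB : B ⊆ F) (hA' : A.Nonempty) (hB' : B.Nonempty) :
    ∃ (n : ℕ) (s : ℕ → V), (∀ i ≤ n, s i ∈ F) ∧ s 0 ∈ A ∧ s n ∈ B ∧ (∀ i ≤ n, s i ∈ A → i = 0) ∧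
      (∀ i ≤ n, s i ∈ B → i = n) ∧ G.IsInducedPathSeq s n ∧ s n ∈ G.walkLayer F A n := by
  classical
  have hex : ∃ n, ∃ b ∈ B, b ∈ G.walkLayer F A n := by
    obtain ⟨b, hb⟩ := hB'
    obtain ⟨k, hk⟩ := h.exists_mem_walkLayer hA hA' (hB hb)
    exact ⟨k, b, hb, hk⟩
  have hch : ∀ n b, b ∈ G.walkLayer F A n → ∃ s : ℕ → V, s n = b ∧
      (∀ i ≤ n, s i ∈ G.walkLayer F A i) ∧ ∀ i < n, G.Adj (s i) (s (i + 1)) := by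
    intro n
    induction n with
    | zero => exact fun b hb => ⟨fun _ => b, rfl, fun i hi => by
        obtain rfl : i = 0 := by omega
        exact hb, fun i hi => by omega⟩
    | succ n ih =>
      rintro b ⟨hbF, w, hw, hwb⟩
      obtain ⟨s, hs, hs1, hs2⟩ := ih w hw
      refine ⟨fun i => if i ≤ n then s i else b, by simp, fun i hi => ?_, fun i hi => ?_⟩
      · by_cases hin : i ≤ n
        · simpa [hin] using hs1 i hin
        · obtain rfl : i = n + 1 := by omega
          simpa using ⟨hbF, w, hw, hwb⟩
      · by_cases hin : i + 1 ≤ n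
        · simpa [hin, show i ≤ n by omega] using hs2 i hin
        · obtain rfl : i = n := by omega
          simpa [hs] using hwb
  obtain ⟨b, hb, hbn⟩ := Nat.find_spec hex
  set n := Nat.find hex
  obtain ⟨s, hsb, hs1, hs2⟩ := hch n b hbn
  have hmin : ∀ m, ∀ b ∈ B, b ∈ G.walkLayer F A m → n ≤ m := fun m b hb hm =>
    Nat.find_min' hex ⟨b, hb, hm⟩
  -- walking on along `s` from a vertex `s j` reached in `m` steps reaches `B`
  have hgo : ∀ d m j, j + d = n → s j ∈ G.walkLayer F A m → n ≤ m + d := by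
    intro d
    induction d with
    | zero =>
      intro m j hj hm
      obtain rfl : j = n := by omega
      exact hmin m b hb (hsb ▸ hm)
    | succ d ih =>
      intro m j hj hm
      have := ih (m + 1) (j + 1) (by omega)
        ⟨walkLayer_subset hA _ (hs1 (j + 1) (by omega)), s j, hm, hs2 j (by omega)⟩
      omega
  -- Thus `s j` is at distance exactly `j` from `A` within `F`. This excludes repeated vertices,
  -- chords, and later returns to `A`.
  have hle : ∀ m j, j ≤ n → s j ∈ G.walkLayer F A m → j ≤ m := fun m j hj hm => by
    have := hgo (n - j) m j (by omega) hm
    omega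
  refine ⟨n, s, fun i hi => walkLayer_subset hA _ (hs1 i hi), hs1 0 (by omega), hsb ▸ hb,
    fun i hi hiA => by simpa using hle 0 i hi hiA,
    fun i hi hiB => le_antisymm hi (hmin i _ hiB (hs1 i hi)), fun i j hij hj => ⟨fun he => ?_, ?_⟩,
    hsb ▸ hbn⟩
  · have := hle i j hj (he ▸ hs1 i (by omega))
    omega
  · refine ⟨fun hadj => ?_, fun he => he ▸ hs2 i (by omega)⟩
    have := hle (i + 1) j hj ⟨walkLayer_subset hA _ (hs1 j hj), s i, hs1 i (by omega), hadj⟩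
    omega

/-- A large connected graph has a vertex of large degree or a long induced path. -/
theorem exists_large_neighborSet (c M : ℕ) : ∃ N, ∀ (V : Type u) [Finite V] (G : SimpleGraph V),
    G.AvoidsPathAndMatchedCliques c → ∀ F : Set V, G.ConnectedOn F → N ≤ F.ncard →
      ∃ q ∈ F, M ≤ (G.neighborSet q ∩ F).ncard := by
  classical
  -- If all degrees within `F` are below `M`, the walks of length `k` from `a` reach at most `M ^ k`
  -- vertices. A shortest walk is an induced path, so lengths below `c` already reach all of `F`.
  refine ⟨(∑ k ∈ Finset.range c, M ^ k) + 1, fun V _ G hG F hF hN => ?_⟩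
  by_contra! hdeg
  have := Fintype.ofFinite V
  obtain ⟨a, ha⟩ : F.Nonempty := (Set.ncard_pos (Set.toFinite F)).1 (by omega)
  have haF : ({a} : Set V) ⊆ F := by simpa using ha
  have hl : ∀ k, (G.walkLayer F {a} k).ncard ≤ M ^ k := by
    intro k
    induction k with
    | zero => simp [walkLayer]
    | succ k ih =>
      have hsub : (G.walkLayer F {a} (k + 1)) ⊆
          (((G.walkLayer F {a} k).toFinset.biUnion
            fun w => (G.neighborSet w ∩ F).toFinset : Finset V) : Set V) := by
        rintro u ⟨hu, w, hw, hwu⟩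
        simp only [Finset.coe_biUnion, Set.mem_iUnion, Finset.mem_coe, Set.mem_toFinset]
        exact ⟨w, hw, hwu, hu⟩
      refine (Set.ncard_le_ncard hsub (Set.toFinite _)).trans ?_
      rw [Set.ncard_coe_finset]
      refine (Finset.card_biUnion_le_card_mul _ _ M fun w hw => ?_).trans ?_
      · rw [← Set.ncard_eq_toFinset_card']
        exact (hdeg w (walkLayer_subset haF k (by simpa using hw))).le
      · rw [← Set.ncard_eq_toFinset_card', pow_succ]
        gcongr
  have hcov : F ⊆ (((Finset.range c).biUnion
      fun k => (G.walkLayer F {a} k).toFinset : Finset V) : Set V) := by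
    intro b hb
    by_contra hcon
    obtain ⟨n, s, -, -, hsb, -, -, hs, hsn⟩ := hF.exists_isInducedPathSeq haF
      (B := {b}) (by simpa using hb) ⟨a, rfl⟩ ⟨b, rfl⟩
    obtain rfl : s n = b := hsb
    apply hcon
    simp only [Finset.coe_biUnion, Set.mem_iUnion, Finset.mem_coe, Set.mem_toFinset]
    exact ⟨n, by simpa using (Nat.lt_of_succ_lt (hs.lt hG)), hsn⟩
  have h1 := Set.ncard_le_ncard hcov (Set.toFinite _)
  rw [Set.ncard_coe_finset] at h1
  have h2 : ∑ k ∈ Finset.range c, (G.walkLayer F {a} k).toFinset.card ≤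
      ∑ k ∈ Finset.range c, M ^ k :=
    Finset.sum_le_sum fun k _ => by rw [← Set.ncard_eq_toFinset_card']; exact hl k
  have h3 := h1.trans (Finset.card_biUnion_le.trans h2)
  omega

/-! ### Matched cliques from two linked vertices -/

/-- Complementing at `z` turns the `x i` into a clique, and complementing at `v` does the same for
the `y i`. As `z` and `v` are not adjacent, neither operation disturbs the other, and the matching
is untouched. -/
theorem hasVertexMinorIso_matchingJoin_of_not_adj {G : SimpleGraph V} {c : ℕ} {z v : V}
    {x y : ℕ → V} (hadj : ¬ G.Adj z v)
    (hzx : ∀ i < c, G.Adj z (x i)) (hzy : ∀ i < c, ¬ G.Adj z (y i))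
    (hvy : ∀ i < c, G.Adj v (y i)) (hvx : ∀ i < c, ¬ G.Adj v (x i))
    (hxy : ∀ i < c, ∀ j < c, G.Adj (x i) (y j) ↔ i = j)
    (hxx : ∀ i < c, ∀ j < c, ¬ G.Adj (x i) (x j)) (hyy : ∀ i < c, ∀ j < c, ¬ G.Adj (y i) (y j)) :
    G.HasVertexMinorIso (matchingJoin (⊤ : SimpleGraph (Fin c)) (⊤ : SimpleGraph (Fin c))) := by
  have nxx : ∀ i < c, ∀ j < c, i ≠ j → x i ≠ x j := fun i hi j hj hij h =>
    hij (((hxy i hi j hj).1 (h ▸ (hxy j hj j hj).2 rfl)))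
  have nyy : ∀ i < c, ∀ j < c, i ≠ j → y i ≠ y j := fun i hi j hj hij h =>
    hij (((hxy i hi j hj).1 (h ▸ (hxy i hi i hi).2 rfl)))
  have nxy : ∀ i < c, ∀ j < c, x i ≠ y j := fun i hi j hj h => hzy j hj (h ▸ hzx i hi)
  have h1 : ∀ i, (G.localComplement z).Adj v i ↔ G.Adj v i :=
    fun i => localComplement_adj_of_not hadj
  have h2 : ∀ i < c, ∀ j, (G.localComplement z).Adj (y i) j ↔ G.Adj (y i) j :=
    fun i hi j => localComplement_adj_of_not (hzy i hi)
  refine (hasVertexMinorIso_of_injective (G := (G.localComplement z).localComplement v)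
    (f := Sum.elim (fun i : Fin c => x i) (fun i : Fin c => y i)) ?_ ?_).of_locallyEquivalent
    ((locallyEquivalent_localComplement G z).localComplement v)
  · rintro (i | i) (j | j) hij
    · by_contra hne
      exact nxx i i.2 j j.2 (fun h => hne (by rw [Fin.ext h])) hij
    · exact (nxy i i.2 j j.2 hij).elim
    · exact (nxy j j.2 i i.2 hij.symm).elim
    · by_contra hne
      exact nyy i i.2 j j.2 (fun h => hne (by rw [Fin.ext h])) hij
  · have hxl : ∀ i < c, ∀ j, ((G.localComplement z).localComplement v).Adj (x i) j ↔
        (G.localComplement z).Adj (x i) j := fun i hi j =>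
      localComplement_adj_of_not (by rw [h1]; exact hvx i hi)
    have hxy' : ∀ i j : Fin c, ((G.localComplement z).localComplement v).Adj (x i) (y j) ↔
        i = j := fun i j => by
      rw [hxl i i.2, adj_comm, h2 j j.2, adj_comm, hxy i i.2 j j.2, Fin.ext_iff]
    rintro (i | i) (j | j)
    · by_cases hij : i = j
      · subst hij; simp
      · have hne : i.1 ≠ j.1 := fun h => hij (Fin.ext h)
        simp only [Sum.elim_inl, hxl i i.2, localComplement_adj (nxx i i.2 j j.2 hne), hxx i i.2 j j.2,
          hzx i i.2, hzx j j.2, matchingJoin, top_adj]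
        simp [hij]
    · simpa [matchingJoin] using hxy' i j
    · rw [adj_comm]
      simpa [eq_comm, matchingJoin] using hxy' j i
    · by_cases hij : i = j
      · subst hij; simp
      · have hne : i.1 ≠ j.1 := fun h => hij (Fin.ext h)
        simp only [Sum.elim_inr, localComplement_adj (nyy i i.2 j j.2 hne), h1,
          hzy i i.2, hyy i i.2 j j.2, hvy i i.2, hvy j j.2, matchingJoin, top_adj]
        simp [hij]

/-- One rung is sacrificed to remove a possible edge `zv`: complementing at `x 0` joins `y 0` to
`z`, and complementing at `y 0`, now a common neighbor of `z` and `v`, deletes `zv`. The remaining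
`c` rungs miss `x 0` and `y 0` and do not change. -/
theorem hasVertexMinorIso_matchingJoin {G : SimpleGraph V} {c : ℕ} {z v : V}
    {x y : ℕ → V} (hzv : z ≠ v)
    (hzx : ∀ i < c + 1, G.Adj z (x i)) (hzy : ∀ i < c + 1, ¬ G.Adj z (y i) ∧ y i ≠ z)
    (hvy : ∀ i < c + 1, G.Adj v (y i)) (hvx : ∀ i < c + 1, ¬ G.Adj v (x i) ∧ x i ≠ v)
    (hxy : ∀ i < c + 1, ∀ j < c + 1, G.Adj (x i) (y j) ↔ i = j)
    (hxx : ∀ i < c + 1, ∀ j < c + 1, ¬ G.Adj (x i) (x j))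
    (hyy : ∀ i < c + 1, ∀ j < c + 1, ¬ G.Adj (y i) (y j)) :
    G.HasVertexMinorIso (matchingJoin (⊤ : SimpleGraph (Fin c)) (⊤ : SimpleGraph (Fin c))) := by
  by_cases hadj : G.Adj z v
  · set H := (G.localComplement (x 0)).localComplement (y 0)
    have a1 : ∀ j < c, ¬ G.Adj (x 0) (x (j + 1)) := fun j hj => hxx _ (by omega) _ (by omega)
    have a2 : ∀ j < c, ¬ G.Adj (x 0) (y (j + 1)) := fun j hj => by
      rw [hxy _ (by omega) _ (by omega)]; omega
    have a3 : ∀ j < c, ¬ G.Adj (y 0) (x (j + 1)) := fun j hj => by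
      rw [adj_comm, hxy _ (by omega) _ (by omega)]; omega
    have a4 : ∀ j < c, ¬ G.Adj (y 0) (y (j + 1)) := fun j hj => hyy _ (by omega) _ (by omega)
    have b1 : ∀ j < c, ∀ a, H.Adj a (x (j + 1)) ↔ G.Adj a (x (j + 1)) := fun j hj a => by
      rw [localComplement_adj_of_not', localComplement_adj_of_not' (a1 j hj)]
      rw [localComplement_adj_of_not' (a1 j hj)]; exact a3 j hj
    have b2 : ∀ j < c, ∀ a, H.Adj a (y (j + 1)) ↔ G.Adj a (y (j + 1)) := fun j hj a => by
      rw [localComplement_adj_of_not', localComplement_adj_of_not' (a2 j hj)]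
      rw [localComplement_adj_of_not' (a2 j hj)]; exact a4 j hj
    have b3 : ¬ H.Adj z v := by
      have e1 : G.Adj (x 0) (y 0) := (hxy 0 (by omega) 0 (by omega)).2 rfl
      have e2 : G.Adj (x 0) z := (hzx 0 (by omega)).symm
      have e3 : ¬ G.Adj (x 0) v := fun h => (hvx 0 (by omega)).1 h.symm
      have e4 : ¬ G.Adj (y 0) z := fun h => (hzy 0 (by omega)).1 h.symm
      have e5 : G.Adj (y 0) v := (hvy 0 (by omega)).symm
      have e6 : (G.localComplement (x 0)).Adj (y 0) z := by
        rw [localComplement_adj (hzy 0 (by omega)).2]; simp [e1, e2, e4]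
      have e7 : (G.localComplement (x 0)).Adj (y 0) v := by
        rwa [localComplement_adj_of_not' e3]
      have e8 : (G.localComplement (x 0)).Adj z v := by
        rwa [localComplement_adj_of_not' e3]
      rw [localComplement_adj hzv]
      simp [e6, e7, e8]
    refine (hasVertexMinorIso_matchingJoin_of_not_adj (G := H) (x := fun i => x (i + 1))
      (y := fun i => y (i + 1)) b3 ?_ ?_ ?_ ?_ ?_ ?_ ?_).of_locallyEquivalent
      ((locallyEquivalent_localComplement G (x 0)).localComplement (y 0))
    · exact fun i hi => (b1 i hi z).2 (hzx _ (by omega))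
    · exact fun i hi => (b2 i hi z).not.2 (hzy _ (by omega)).1
    · exact fun i hi => (b2 i hi v).2 (hvy _ (by omega))
    · exact fun i hi => (b1 i hi v).not.2 (hvx _ (by omega)).1
    · exact fun i hi j hj => (b2 j hj _).trans ((hxy _ (by omega) _ (by omega)).trans (by omega))
    · exact fun i hi j hj => (b1 j hj _).not.2 (hxx _ (by omega) _ (by omega))
    · exact fun i hi j hj => (b2 j hj _).not.2 (hyy _ (by omega) _ (by omega))
  · exact hasVertexMinorIso_matchingJoin_of_not_adj hadj (fun i hi => hzx i (by omega))
      (fun i hi => (hzy i (by omega)).1) (fun i hi => hvy i (by omega))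
      (fun i hi => (hvx i (by omega)).1) (fun i hi j hj => hxy i (by omega) j (by omega))
      (fun i hi j hj => hxx i (by omega) j (by omega))
      (fun i hi j hj => hyy i (by omega) j (by omega))

/-- Complementing at `s 1`, whose neighbors among the path, `z` and `v` are just `s 0` and `s 2`,
creates the chord that bypasses it, so the path shortens to a single edge. If `z` is also adjacent
to the last vertex (`ε`), complementing at `s 0` at the end deletes that edge. All operations are at
vertices without neighbors in `W`, which protects the rest of the configuration. -/
theorem exists_locallyEquivalent_contract_path {z v : V} {W : Set V} {ε : Prop} :
    ∀ (n : ℕ) (G : SimpleGraph V) (s : ℕ → V), G.IsInducedPathSeq s (n + 1) →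
      (∀ i ≤ n + 1, s i ≠ z ∧ s i ≠ v) →
      (∀ i ≤ n + 1, G.Adj z (s i) ↔ i = 0 ∨ (i = n + 1 ∧ ε)) →
      (∀ i ≤ n + 1, G.Adj v (s i) ↔ i = n + 1) → (∀ i ≤ n + 1, ∀ w ∈ W, ¬ G.Adj (s i) w) →
      ∃ G', G.LocallyEquivalent G' ∧ G'.Adj (s 0) (s (n + 1)) ∧ G'.Adj z (s 0) ∧
        ¬ G'.Adj z (s (n + 1)) ∧ G'.Adj v (s (n + 1)) ∧ ¬ G'.Adj v (s 0) ∧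
        ∀ a ∈ W, ∀ b, G'.Adj a b ↔ G.Adj a b := by
  intro n
  induction n with
  | zero =>
    intro G s hs hn hz hv hWs
    have h01 := hs 0 1 (by omega) (by omega)
    have h1 : G.Adj (s 0) (s 1) := by simpa using h01.2
    have h2 : G.Adj z (s 0) := by simpa using hz 0 (by omega)
    have h3 : G.Adj z (s 1) ↔ ε := by simpa using hz 1 (by omega)
    have h4 : ¬ G.Adj v (s 0) := by simpa using hv 0 (by omega)
    have h5 : G.Adj v (s 1) := by simpa using hv 1 (by omega)
    by_cases hε : ε
    · refine ⟨G.localComplement (s 0), locallyEquivalent_localComplement _ _, ?_, ?_, ?_, ?_, ?_, ?_⟩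
      · rwa [localComplement_adj_self]
      · rwa [localComplement_adj_self']
      · rw [localComplement_adj (hn 1 (by omega)).1.symm]
        simp [h1, h2.symm, h3.2 hε]
      · rwa [localComplement_adj_of_not (fun h => h4 h.symm)]
      · rwa [localComplement_adj_self']
      · intro a ha b
        rw [localComplement_adj_of_not (hWs 0 (by omega) a ha)]
    · exact ⟨G, .refl G, h1, h2, fun h => hε (h3.1 h), h5, h4, fun _ _ _ => Iff.rfl⟩
  | succ n ih =>
    intro G s hs hn hz hv hWs
    have key : ∀ i j, i ≤ n + 1 + 1 → j ≤ n + 1 + 1 → i ≠ j → ¬ (i = 0 ∧ j = 2) →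
        ¬ (i = 2 ∧ j = 0) →
        ((G.localComplement (s 1)).Adj (s i) (s j) ↔ G.Adj (s i) (s j)) := by
      intro i j hi hj hij h1 h2
      rcases eq_or_ne i 1 with rfl | hi1
      · rw [localComplement_adj_self]
      rcases eq_or_ne j 1 with rfl | hj1
      · rw [localComplement_adj_self']
      have hcase : ∀ k, k ≤ n + 1 + 1 → k ≠ 1 → k ≠ 0 → k ≠ 2 → ¬ G.Adj (s 1) (s k) := by
        intro k hk hk1 hk0 hk2 hadj
        have := (hs 1 k (by omega) hk).2.1 hadj
        omega
      by_cases hi' : i = 0 ∨ i = 2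
      · exact localComplement_adj_of_not' (hcase j hj hj1 (by omega) (by omega))
      · exact localComplement_adj_of_not (hcase i hi hi1 (by omega) (by omega))
    have hz1 : ¬ G.Adj (s 1) z := fun h => by
      have := (hz 1 (by omega)).1 h.symm; omega
    have hv1 : ¬ G.Adj (s 1) v := fun h => by
      have := (hv 1 (by omega)).1 h.symm; omega
    refine (ih (G.localComplement (s 1)) (fun k => if k = 0 then s 0 else s (k + 1))
      ?_ ?_ ?_ ?_ ?_).imp fun G' ⟨hG', h1, h2, h3, h4, h5, h6⟩ => ?_
    · intro i j hij hj
      have hj0 : j ≠ 0 := by omega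
      simp only [hj0, if_false]
      by_cases hi : i = 0
      · subst hi
        simp only [if_true]
        refine ⟨(hs 0 (j + 1) (by omega) (by omega)).1, ?_⟩
        by_cases hj1 : j = 1
        · subst hj1
          have e1 := (hs 1 2 (by omega) (by omega)).2.2 rfl
          have e2 := ((hs 0 1 (by omega) (by omega)).2.2 rfl).symm
          have e3 := (hs 0 2 (by omega) (by omega))
          have e4 : ¬ G.Adj (s 0) (s 2) := fun h => by simpa using e3.2.1 h
          rw [localComplement_adj e3.1]
          simp [e1, e2, e4]
        · rw [key 0 (j + 1) (by omega) (by omega) (by omega) (by omega) (by omega),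
            (hs 0 (j + 1) (by omega) (by omega)).2]
          omega
      · simp only [hi, if_false]
        refine ⟨(hs (i + 1) (j + 1) (by omega) (by omega)).1, ?_⟩
        rw [key (i + 1) (j + 1) (by omega) (by omega) (by omega) (by omega) (by omega),
          (hs (i + 1) (j + 1) (by omega) (by omega)).2]
        omega
    · intro i hi
      by_cases h0 : i = 0
      · simpa [h0] using hn 0 (by omega)
      · simpa [h0] using hn (i + 1) (by omega)
    · intro i hi
      rw [localComplement_adj_of_not hz1]
      by_cases h0 : i = 0
      · simpa [h0] using hz 0 (by omega)
      · simpa [h0] using hz (i + 1) (by omega)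
    · intro i hi
      rw [localComplement_adj_of_not hv1]
      by_cases h0 : i = 0
      · simpa [h0] using hv 0 (by omega)
      · simpa [h0] using hv (i + 1) (by omega)
    · intro i hi w hw
      rw [localComplement_adj_of_not' (hWs 1 (by omega) w hw)]
      by_cases h0 : i = 0
      · simpa [h0] using hWs 0 (by omega) w hw
      · simpa [h0] using hWs (i + 1) (by omega) w hw
    · refine ⟨(locallyEquivalent_localComplement _ _).trans hG', by simpa using h1,
        by simpa using h2, by simpa using h3, by simpa using h4, by simpa using h5,
        fun a ha b => ?_⟩
      rw [h6 a ha, localComplement_adj_of_not (hWs 1 (by omega) a ha)]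

/-- `F` is connected, and `z` and `v` have different nonempty neighborhoods in `F`. -/
structure LinkedBy (G : SimpleGraph V) (z v : V) (F : Set V) : Prop where
  conn : G.ConnectedOn F
  left_notMem : z ∉ F
  right_notMem : v ∉ F
  left_adj : ∃ x ∈ F, G.Adj z x
  right_adj : ∃ x ∈ F, G.Adj v x
  ne : ∃ x ∈ F, ¬ (G.Adj z x ↔ G.Adj v x)

/-- The adjacencies in an induced path `z, x, y, v`, except that `z` and `v` may be adjacent. -/
structure IsRung (G : SimpleGraph V) (z v x y : V) : Prop where
  xy : G.Adj x y
  zx : G.Adj z x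
  not_zy : ¬ G.Adj z y
  vy : G.Adj v y
  not_vx : ¬ G.Adj v x

theorem IsRung.symm {G : SimpleGraph V} {z v x y : V} (h : G.IsRung z v x y) :
    G.IsRung v z y x := ⟨h.xy.symm, h.vy, h.not_vx, h.zx, h.not_zy⟩

/-- Up to exchanging `z` and `v`, some vertex of `F` is adjacent to `z` but not to `v`. On a
shortest path in `F` from such vertices to the neighbors of `v`, `v` sees only the last vertex and
`z` only the first and possibly the last; this path is then contracted to an edge. -/
theorem LinkedBy.exists_isRung {G : SimpleGraph V} {z v : V} {F W : Set V} (h : G.LinkedBy z v F)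
    (hzv : z ≠ v) (hW : ∀ a ∈ F, ∀ w ∈ W, ¬ G.Adj a w) :
    ∃ G', G.LocallyEquivalent G' ∧ (∃ x ∈ F, ∃ y ∈ F, G'.IsRung z v x y) ∧
        ∀ a ∈ W, ∀ b, G'.Adj a b ↔ G.Adj a b := by
  have key : ∀ z v : V, z ≠ v → G.LinkedBy z v F → (∃ x ∈ F, G.Adj z x ∧ ¬ G.Adj v x) →
      ∃ G', G.LocallyEquivalent G' ∧ (∃ x ∈ F, ∃ y ∈ F, G'.IsRung z v x y) ∧
        ∀ a ∈ W, ∀ b, G'.Adj a b ↔ G.Adj a b := by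
    clear h hzv z v
    rintro z v hzv h ⟨x₀, hx₀, hx₀'⟩
    obtain ⟨n, s, hsF, hs0, hsn, hsA, hsB, hs, -⟩ := h.conn.exists_isInducedPathSeq
      (A := {x | x ∈ F ∧ G.Adj z x ∧ ¬ G.Adj v x}) (B := {x | x ∈ F ∧ G.Adj v x})
      (fun x hx => hx.1) (fun x hx => hx.1) ⟨x₀, hx₀, hx₀'⟩ h.right_adj
    obtain ⟨n, rfl⟩ : ∃ m, n = m + 1 := by
      rcases n with _ | n
      · exact (hs0.2.2 hsn.2).elim
      · exact ⟨n, rfl⟩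
    have hv : ∀ i ≤ n + 1, G.Adj v (s i) ↔ i = n + 1 := fun i hi =>
      ⟨fun h => hsB i hi ⟨hsF i hi, h⟩, fun h => h ▸ hsn.2⟩
    obtain ⟨G', hG', h1, h2, h3, h4, h5, h6⟩ := exists_locallyEquivalent_contract_path (W := W)
      (z := z) (v := v) (ε := G.Adj z (s (n + 1))) n G s hs
      (fun i hi => ⟨fun he => h.left_notMem (he ▸ hsF i hi),
        fun he => h.right_notMem (he ▸ hsF i hi)⟩)
      (fun i hi => ⟨fun hz => by
          by_cases hvi : G.Adj v (s i)
          · have := (hv i hi).1 hvi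
            exact .inr ⟨this, this ▸ hz⟩
          · exact .inl (hsA i hi ⟨hsF i hi, hz, hvi⟩),
        fun hi => by
          rcases hi with rfl | ⟨rfl, hi⟩
          · exact hs0.2.1
          · assumption⟩) hv
      (fun i hi w hw => hW _ (hsF i hi) w hw)
    exact ⟨G', hG', ⟨s 0, hsF _ (by omega), s (n + 1), hsF _ le_rfl, h1, h2, h3, h4, h5⟩, h6⟩
  obtain ⟨x, hx, hne⟩ := h.ne
  by_cases hzx : G.Adj z x
  · exact key z v hzv h ⟨x, hx, hzx, fun hv => hne (by tauto)⟩
  · obtain ⟨G', hG', ⟨x, hx, y, hy, hr⟩, h'⟩ := key v z hzv.symm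
      ⟨h.conn, h.right_notMem, h.left_notMem, h.right_adj, h.left_adj,
        ⟨x, hx, fun h => hne h.symm⟩⟩ ⟨x, hx, by tauto, hzx⟩
    exact ⟨G', hG', ⟨y, hy, x, hx, hr.symm⟩, h'⟩

/-- Two vertices linked by many connected sets without edges between them yield two matched
cliques. -/
theorem AvoidsPathAndMatchedCliques.false_of_linkedBy {G : SimpleGraph V} {c : ℕ}
    (hG : G.AvoidsPathAndMatchedCliques c) {z v : V} {F : ℕ → Set V} (hzv : z ≠ v)
    (hd : ∀ i < c + 1, ∀ j < c + 1, i ≠ j → ∀ a ∈ F i, ∀ b ∈ F j, ¬ G.Adj a b)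
    (hF : ∀ i < c + 1, G.LinkedBy z v (F i)) : False := by
  -- The sets are contracted one at a time. When `F k` is treated, the rungs already built and the
  -- sets still to come are put into the protected set `W`.
  have key : ∀ k ≤ c + 1, ∃ G', G.LocallyEquivalent G' ∧ ∃ x y : ℕ → V,
      (∀ i < k, x i ∈ F i ∧ y i ∈ F i ∧ G'.IsRung z v (x i) (y i)) ∧
      (∀ i < k, ∀ j < k, i ≠ j → ¬ G'.Adj (x i) (x j) ∧ ¬ G'.Adj (x i) (y j) ∧
        ¬ G'.Adj (y i) (y j)) ∧
      ∀ i, k ≤ i → i < c + 1 → ∀ a ∈ F i, ∀ b, G'.Adj a b ↔ G.Adj a b := by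
    intro k
    induction k with
    | zero => exact fun _ => ⟨G, .refl G, fun _ => z, fun _ => z, by simp, by simp, by simp⟩
    | succ k ih =>
      intro hk
      obtain ⟨G', hG', x, y, h1, h2, h3⟩ := ih (by omega)
      have h3k := h3 k le_rfl (by omega)
      have hFk := hF k (by omega)
      have hlink : G'.LinkedBy z v (F k) :=
        { conn := hFk.conn.congr fun a ha b _ h => (h3k a ha b).2 h
          left_notMem := hFk.left_notMem
          right_notMem := hFk.right_notMem
          left_adj := hFk.left_adj.imp fun a ha => ⟨ha.1, by
            rw [adj_comm, h3k a ha.1, adj_comm]; exact ha.2⟩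
          right_adj := hFk.right_adj.imp fun a ha => ⟨ha.1, by
            rw [adj_comm, h3k a ha.1, adj_comm]; exact ha.2⟩
          ne := hFk.ne.imp fun a ha => ⟨ha.1, by
            rw [G'.adj_comm, h3k a ha.1, G'.adj_comm, h3k a ha.1, G.adj_comm, G.adj_comm a v]
            exact ha.2⟩ }
      obtain ⟨G'', hG'', ⟨x', hx', y', hy', hr⟩, h4⟩ := hlink.exists_isRung
        (W := {w | (∃ i < k, w = x i ∨ w = y i) ∨ ∃ i, k < i ∧ i < c + 1 ∧ w ∈ F i}) hzv (by
          rintro a ha w (⟨i, hi, rfl | rfl⟩ | ⟨i, hi, hic, hw⟩)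
          · rw [h3k a ha]; exact hd _ (by omega) _ (by omega) (by omega) a ha _ (h1 i hi).1
          · rw [h3k a ha]; exact hd _ (by omega) _ (by omega) (by omega) a ha _ (h1 i hi).2.1
          · rw [h3k a ha]; exact hd _ (by omega) _ (by omega) (by omega) a ha _ hw)
      have hxW : ∀ i < k, ∀ b, G''.Adj (x i) b ↔ G'.Adj (x i) b :=
        fun i hi => h4 _ (.inl ⟨i, hi, .inl rfl⟩)
      have hyW : ∀ i < k, ∀ b, G''.Adj (y i) b ↔ G'.Adj (y i) b :=
        fun i hi => h4 _ (.inl ⟨i, hi, .inr rfl⟩)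
      have hold : ∀ i < k, ∀ a ∈ F k, ¬ G''.Adj (x i) a ∧ ¬ G''.Adj (y i) a := fun i hi a ha => by
        rw [hxW i hi, hyW i hi, G'.adj_comm, h3k a ha, G'.adj_comm, h3k a ha]
        exact ⟨hd _ (by omega) _ (by omega) (by omega) a ha _ (h1 i hi).1,
          hd _ (by omega) _ (by omega) (by omega) a ha _ (h1 i hi).2.1⟩
      refine ⟨G'', hG'.trans hG'', fun i => if i < k then x i else x',
        fun i => if i < k then y i else y', fun i hi => ?_, fun i hi j hj hij => ?_,
        fun i hi hic a ha b => ?_⟩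
      · by_cases hik : i < k
        · obtain ⟨ha, hb, hrung⟩ := h1 i hik
          simp only [hik, if_true]
          refine ⟨ha, hb, (hxW i hik _).2 hrung.xy, ?_, ?_, ?_, ?_⟩
          · rw [adj_comm, hxW i hik, adj_comm]; exact hrung.zx
          · rw [adj_comm, hyW i hik, adj_comm]; exact hrung.not_zy
          · rw [adj_comm, hyW i hik, adj_comm]; exact hrung.vy
          · rw [adj_comm, hxW i hik, adj_comm]; exact hrung.not_vx
        · obtain rfl : i = k := by omega
          simpa [hik] using ⟨hx', hy', hr⟩
      · by_cases hik : i < k <;> by_cases hjk : j < k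
        · simp only [hik, hjk, if_true, hxW i hik, hyW i hik]
          exact h2 i hik j hjk hij
        · simp only [hik, hjk, if_true, if_false]
          exact ⟨(hold i hik x' hx').1, (hold i hik y' hy').1, (hold i hik y' hy').2⟩
        · simp only [hik, hjk, if_true, if_false]
          rw [G''.adj_comm, G''.adj_comm x', G''.adj_comm y']
          exact ⟨(hold j hjk x' hx').1, (hold j hjk x' hx').2, (hold j hjk y' hy').2⟩
        · omega
      · rw [h4 a (.inr ⟨i, by omega, hic, ha⟩), h3 i (by omega) hic a ha]
  obtain ⟨G', hG', x, y, h1, h2, -⟩ := key (c + 1) le_rfl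
  refine hG.2 (HasVertexMinorIso.of_locallyEquivalent ?_ hG')
  refine hasVertexMinorIso_matchingJoin (z := z) (v := v) (x := x) (y := y) hzv
    (fun i hi => (h1 i hi).2.2.zx)
    (fun i hi => ⟨(h1 i hi).2.2.not_zy, fun h => (hF i hi).left_notMem (h ▸ (h1 i hi).2.1)⟩)
    (fun i hi => (h1 i hi).2.2.vy)
    (fun i hi => ⟨(h1 i hi).2.2.not_vx, fun h => (hF i hi).right_notMem (h ▸ (h1 i hi).1)⟩)
    (fun i hi j hj => ?_) (fun i hi j hj => ?_) (fun i hi j hj => ?_)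
  · rcases eq_or_ne i j with rfl | hij
    · simpa using (h1 i hi).2.2.xy
    · simpa [hij] using (h2 i hi j hj hij).2.1
  · rcases eq_or_ne i j with rfl | hij
    · simp
    · exact (h2 i hi j hj hij).1
  · rcases eq_or_ne i j with rfl | hij
    · simp
    · exact (h2 i hi j hj hij).2.2

/-! ### Long paths from threshold graphs and half graphs -/

/-- Complementing successively at `u 0, …, u c` turns this threshold graph into a path. After step
`k` the initial part is a path ending in `u k`, which still sees all later vertices, while the rule
among the later vertices has switched parity. So `u (k + 1)` sees everything after it, and
complementing there cuts `u k` off from everything beyond `u (k + 1)`. -/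
theorem AvoidsPathAndMatchedCliques.false_of_threshold {G : SimpleGraph V} {c : ℕ}
    (hG : G.AvoidsPathAndMatchedCliques c) (u : ℕ → V)
    (hu : ∀ s t, s < t → t < c + 1 → u s ≠ u t ∧ (G.Adj (u s) (u t) ↔ Even s)) : False := by
  have key : ∀ k < c + 1, ∃ G', G.LocallyEquivalent G' ∧ ∀ s t, s < t → t < c + 1 →
      (s < k → (G'.Adj (u s) (u t) ↔ s + 1 = t)) ∧ (s = k → G'.Adj (u s) (u t)) ∧
      (k < s → (G'.Adj (u s) (u t) ↔ Odd (s + k))) := by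
    intro k
    induction k with
    | zero =>
      refine fun _ => ⟨G.localComplement (u 0), locallyEquivalent_localComplement _ _,
        fun s t hst ht => ⟨by omega, ?_, fun hs => ?_⟩⟩
      · rintro rfl
        rw [localComplement_adj_self, (hu 0 t hst ht).2]; simp
      · rw [localComplement_adj (hu s t hst ht).1, (hu s t hst ht).2,
          (hu 0 s hs (by omega)).2, (hu 0 t (by omega) ht).2]
        simp
    | succ k ih =>
      intro hk
      obtain ⟨G', hG', h⟩ := ih (by omega)
      have hadj : ∀ t, k + 1 < t → t < c + 1 → G'.Adj (u (k + 1)) (u t) := fun t h1 h2 =>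
        ((h (k + 1) t h1 h2).2.2 (by omega)).2 ⟨k, by ring⟩
      have hback : G'.Adj (u (k + 1)) (u k) := ((h k (k + 1) (by omega) hk).2.1 rfl).symm
      refine ⟨G'.localComplement (u (k + 1)), hG'.localComplement _,
        fun s t hst ht => ⟨fun hs => ?_, ?_, fun hs => ?_⟩⟩
      · rcases Nat.lt_or_ge s k with hsk | hsk
        · have : ¬ G'.Adj (u (k + 1)) (u s) := fun hh => by
            have := ((h s (k + 1) (by omega) hk).1 hsk).1 hh.symm
            omega
          rw [localComplement_adj_of_not this]
          exact (h s t hst ht).1 hsk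
        · obtain rfl : s = k := by omega
          rcases eq_or_ne t (s + 1) with rfl | hts
          · rw [localComplement_adj_self']; simpa using hback.symm
          · rw [localComplement_adj (hu s t hst ht).1]
            simp [hback, hadj t (by omega) ht, (h s t hst ht).2.1 rfl, hts.symm]
      · rintro rfl
        rw [localComplement_adj_self]; exact hadj t hst ht
      · rw [localComplement_adj (hu s t hst ht).1, (h s t hst ht).2.2 (by omega)]
        simp only [hadj s hs (by omega), hadj t (by omega) ht, and_self, not_true_eq_false, iff_false]
        rw [← add_assoc, Nat.odd_add_one]
  obtain ⟨G', hG', h⟩ := key c (by omega)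
  have hp : G'.IsInducedPathSeq u c := fun s t hst ht =>
    ⟨(hu s t hst (by omega)).1, (h s t hst (by omega)).1 (by omega)⟩
  have := hp.lt (hG.of_locallyEquivalent hG')
  omega

/-- If the `a i` form a clique, the order `a 0, b 0, a 1, b 1, …` is a threshold order. If they are
stable, complementing at `b (c + 1)`, which sees all the `a i` in use and none of the other `b i`,
makes them a clique. -/
theorem AvoidsPathAndMatchedCliques.false_of_chain {G : SimpleGraph V} {c : ℕ}
    (hG : G.AvoidsPathAndMatchedCliques c) {a b : ℕ → V} {γ : Prop}
    (hne : ∀ i < c + 2, ∀ j < c + 2, a i ≠ b j)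
    (hab : ∀ i < c + 2, ∀ j < c + 2, G.Adj (a i) (b j) ↔ i ≤ j)
    (ha : ∀ i j, i < j → j < c + 2 → a i ≠ a j ∧ (G.Adj (a i) (a j) ↔ γ))
    (hb : ∀ i j, i < j → j < c + 2 → b i ≠ b j ∧ ¬ G.Adj (b i) (b j)) : False := by
  by_cases hγ : γ
  · refine hG.false_of_threshold (fun s => if Even s then a (s / 2) else b (s / 2))
      fun s t hst ht => ?_
    by_cases hs : Even s <;> by_cases ht' : Even t
    · simp only [hs, ht', if_true, iff_true]
      have := ha (s / 2) (t / 2) (by grind) (by omega)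
      exact ⟨this.1, this.2.2 hγ⟩
    · simp only [hs, ht', if_true, if_false, iff_true]
      exact ⟨hne _ (by omega) _ (by omega), (hab _ (by omega) _ (by omega)).2 (by omega)⟩
    · simp only [hs, ht', if_true, if_false, iff_false]
      refine ⟨(hne _ (by omega) _ (by omega)).symm, fun h => ?_⟩
      have := (hab _ (by omega) _ (by omega)).1 h.symm
      grind
    · simp only [hs, ht', if_false, iff_false]
      exact hb _ _ (by grind) (by omega)
  · refine (hG.of_locallyEquivalent
      (locallyEquivalent_localComplement G (b (c + 1)))).false_of_threshold
      (fun s => if Even s then a (s / 2) else b (s / 2)) fun s t hst ht => ?_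
    have hbl : ∀ i < c + 1, ¬ G.Adj (b (c + 1)) (b i) := fun i hi h =>
      (hb i (c + 1) hi (by omega)).2 h.symm
    have hal : ∀ i < c + 1, G.Adj (b (c + 1)) (a i) := fun i hi =>
      ((hab i (by omega) (c + 1) (by omega)).2 (by omega)).symm
    by_cases hs : Even s <;> by_cases ht' : Even t
    · simp only [hs, ht', if_true, iff_true]
      have := ha (s / 2) (t / 2) (by grind) (by omega)
      refine ⟨this.1, ?_⟩
      rw [localComplement_adj this.1, this.2]
      simp [hγ, hal (s / 2) (by omega), hal (t / 2) (by omega)]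
    · simp only [hs, ht', if_true, if_false, iff_true]
      refine ⟨hne _ (by omega) _ (by omega), ?_⟩
      rw [localComplement_adj_of_not' (hbl _ (by omega))]
      exact (hab _ (by omega) _ (by omega)).2 (by omega)
    · simp only [hs, ht', if_true, if_false, iff_false]
      rw [localComplement_adj_of_not (hbl _ (by omega))]
      refine ⟨(hne _ (by omega) _ (by omega)).symm, fun h => ?_⟩
      have := (hab _ (by omega) _ (by omega)).1 h.symm
      grind
    · simp only [hs, ht', if_false, iff_false]
      rw [localComplement_adj_of_not (hbl _ (by omega))]
      exact hb _ _ (by grind) (by omega)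

/-- A half graph between a stable set and a set that is stable or a clique yields a path. -/
theorem AvoidsPathAndMatchedCliques.false_of_halfGraph {G : SimpleGraph V} {c : ℕ}
    (hG : G.AvoidsPathAndMatchedCliques c) {v x : ℕ → V} {α γ : Prop}
    (h : ∀ i j, i < j → j < 2 * c + 4 → v i ≠ v j ∧ x i ≠ x j ∧ v i ≠ x j ∧ v j ≠ x i ∧
      (G.Adj (v i) (x j) ↔ α) ∧ (G.Adj (v j) (x i) ↔ ¬ α) ∧ ¬ G.Adj (x i) (x j) ∧
      (G.Adj (v i) (v j) ↔ γ)) : False := by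
  -- The adjacency of `v i` and `x i` is unknown, so `v` and `x` are sampled at indices of opposite
  -- parity. When `α` fails, the order is reversed.
  by_cases hα : α
  · refine hG.false_of_chain (a := fun k => v (2 * k)) (b := fun l => x (2 * l + 1)) (γ := γ)
      (fun i hi j hj => ?_) (fun i hi j hj => ?_) (fun i j hij hj => ?_) (fun i j hij hj => ?_)
    · rcases Nat.lt_or_ge (2 * i) (2 * j + 1) with hlt | hlt
      · exact (h _ _ hlt (by omega)).2.2.1
      · exact (h (2 * j + 1) (2 * i) (by omega) (by omega)).2.2.2.1
    · rcases Nat.lt_or_ge (2 * i) (2 * j + 1) with hlt | hlt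
      · rw [(h _ _ hlt (by omega)).2.2.2.2.1]
        exact iff_of_true hα (by omega)
      · rw [(h (2 * j + 1) (2 * i) (by omega) (by omega)).2.2.2.2.2.1]
        exact iff_of_false (not_not.2 hα) (by omega)
    · have := h (2 * i) (2 * j) (by omega) (by omega)
      tauto
    · have := h (2 * i + 1) (2 * j + 1) (by omega) (by omega)
      tauto
  · refine hG.false_of_chain (a := fun k => v (2 * c + 3 - 2 * k))
      (b := fun l => x (2 * c + 3 - (2 * l + 1))) (γ := γ)
      (fun i hi j hj => ?_) (fun i hi j hj => ?_) (fun i j hij hj => ?_) (fun i j hij hj => ?_)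
    · rcases Nat.lt_or_ge (2 * i) (2 * j + 1) with hlt | hlt
      · exact (h (2 * c + 3 - (2 * j + 1)) (2 * c + 3 - 2 * i) (by omega) (by omega)).2.2.2.1
      · exact (h (2 * c + 3 - 2 * i) (2 * c + 3 - (2 * j + 1)) (by omega) (by omega)).2.2.1
    · rcases Nat.lt_or_ge (2 * i) (2 * j + 1) with hlt | hlt
      · rw [(h (2 * c + 3 - (2 * j + 1)) (2 * c + 3 - 2 * i) (by omega) (by omega)).2.2.2.2.2.1]
        exact iff_of_true hα (by omega)
      · rw [(h (2 * c + 3 - 2 * i) (2 * c + 3 - (2 * j + 1)) (by omega) (by omega)).2.2.2.2.1]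
        exact iff_of_false hα (by omega)
    · have := h (2 * c + 3 - 2 * j) (2 * c + 3 - 2 * i) (by omega) (by omega)
      rw [G.adj_comm]
      exact ⟨this.1.symm, this.2.2.2.2.2.2.2⟩
    · have := h (2 * c + 3 - (2 * j + 1)) (2 * c + 3 - (2 * i + 1)) (by omega) (by omega)
      rw [G.adj_comm]
      exact ⟨this.2.1.symm, this.2.2.2.2.2.2.1⟩

/-! ### Brooms and vertices attached to their fibers -/

/-- An induced path `z, l` with at least `h` vertices (the handle) together with `w` connected sets
of `ℓ` vertices (the fibers), each of which is joined to the rest of the graph only through `z`. -/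
structure IsBroom (G : SimpleGraph V) (h w ℓ : ℕ) (z : V) (l : List V) (F : ℕ → Set V) : Prop where
  path : G.IsInducedPathList (z :: l)
  length : h ≤ l.length + 1
  card : ∀ i < w, (F i).ncard = ℓ
  conn : ∀ i < w, G.ConnectedOn (F i)
  adj : ∀ i < w, ∃ x ∈ F i, G.Adj z x
  notMem : ∀ i < w, z ∉ F i
  tail : ∀ i < w, ∀ x ∈ F i, ∀ u ∈ l, x ≠ u ∧ ¬ G.Adj x u
  disj : ∀ i < w, ∀ j < w, i ≠ j → ∀ a ∈ F i, ∀ b ∈ F j, a ≠ b ∧ ¬ G.Adj a b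

def HasBroom (G : SimpleGraph V) (h w ℓ : ℕ) : Prop :=
  ∃ z l F, G.IsBroom h w ℓ z l F

theorem IsBroom.comp {G : SimpleGraph V} {h w ℓ m : ℕ} {z : V} {l : List V} {F : ℕ → Set V}
    (H : G.IsBroom h w ℓ z l F) (g : ℕ → ℕ) (hg : ∀ i < m, g i < w)
    (hg' : ∀ i < m, ∀ j < m, i ≠ j → g i ≠ g j) : G.IsBroom h m ℓ z l (fun i => F (g i)) where
  path := H.path
  length := H.length
  card i hi := H.card _ (hg i hi)
  conn i hi := H.conn _ (hg i hi)
  adj i hi := H.adj _ (hg i hi)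
  notMem i hi := H.notMem _ (hg i hi)
  tail i hi := H.tail _ (hg i hi)
  disj i hi j hj hij := H.disj _ (hg i hi) _ (hg j hj) (hg' i hi j hj hij)

theorem ne_of_strictMono {m : ℕ} {g : ℕ → ℕ} (hg : ∀ i j, i < j → j < m → g i < g j) :
    ∀ i < m, ∀ j < m, i ≠ j → g i ≠ g j := fun i hi j hj hij => by
  rcases lt_or_gt_of_ne hij with h | h
  · exact (hg i j h hj).ne
  · exact (hg j i h hi).ne'

theorem IsBroom.comp_strictMono {G : SimpleGraph V} {h w ℓ m : ℕ} {z : V} {l : List V}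
    {F : ℕ → Set V} (H : G.IsBroom h w ℓ z l F) (g : ℕ → ℕ) (hg : ∀ i < m, g i < w)
    (hg' : ∀ i j, i < j → j < m → g i < g j) : G.IsBroom h m ℓ z l (fun i => F (g i)) :=
  H.comp g hg (ne_of_strictMono hg')

/-- Vertices `v i` outside a broom, each attached nontrivially to the fiber `F i`, and uniformly
attached to everything else. -/
structure IsAttached (G : SimpleGraph V) (m : ℕ) (z : V) (l : List V) (F : ℕ → Set V) (v : ℕ → V)
    (α β γ δ : Prop) : Prop where
  notMem_path : ∀ i < m, v i ≠ z ∧ v i ∉ l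
  notMem : ∀ i < m, ∀ j < m, v i ∉ F j
  later : ∀ i j, i < j → j < m → ∀ a ∈ F j, G.Adj (v i) a ↔ α ∧ G.Adj z a
  earlier : ∀ i j, i < j → j < m → ∀ a ∈ F i, G.Adj (v j) a ↔ β ∧ G.Adj z a
  pair : ∀ i j, i < j → j < m → v i ≠ v j ∧ (G.Adj (v i) (v j) ↔ γ)
  center : ∀ i < m, G.Adj z (v i) ↔ δ
  -- If `α` and `β` are false, this gives `v i` a neighbor in its fiber; if both are true, it says
  -- that `v i` and `z` differ there. Pivoting turns the second case into the first.
  own : (α ↔ β) → ∀ i < m, ∃ a ∈ F i, ¬ (G.Adj (v i) a ↔ α ∧ G.Adj z a)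

theorem IsAttached.not_adj {G : SimpleGraph V} {m : ℕ} {z : V} {l : List V} {F : ℕ → Set V}
    {v : ℕ → V} {γ δ : Prop} (H : G.IsAttached m z l F v False False γ δ) {i j : ℕ} (hi : i < m)
    (hj : j < m) (hij : i ≠ j) {a : V} (ha : a ∈ F j) : ¬ G.Adj (v i) a := by
  rcases lt_or_gt_of_ne hij with h | h
  · simpa using H.later i j h hj a ha
  · simpa using H.earlier j i h hi a ha

theorem IsAttached.exists_adj {G : SimpleGraph V} {m : ℕ} {z : V} {l : List V} {F : ℕ → Set V}
    {v : ℕ → V} {γ δ : Prop} (H : G.IsAttached m z l F v False False γ δ) {i : ℕ} (hi : i < m) :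
    ∃ a ∈ F i, G.Adj (v i) a := by
  simpa using H.own Iff.rfl i hi

theorem IsAttached.pair_ne {G : SimpleGraph V} {m : ℕ} {z : V} {l : List V} {F : ℕ → Set V}
    {v : ℕ → V} {α β γ δ : Prop} (H : G.IsAttached m z l F v α β γ δ) {i j : ℕ} (hi : i < m)
    (hj : j < m) (hij : i ≠ j) : v i ≠ v j ∧ (G.Adj (v i) (v j) ↔ γ) := by
  rcases lt_or_gt_of_ne hij with h | h
  · exact H.pair i j h hj
  · rw [adj_comm]
    exact ⟨(H.pair j i h hi).1.symm, (H.pair j i h hi).2⟩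

/-- The center reaches the enlarged fiber through `F i`, while `p` sees only `v` in it. With many
fibers and the same `p`, which is a handle vertex or another attached vertex, this contradicts
`false_of_linkedBy`. -/
theorem IsBroom.linkedBy_insert {G : SimpleGraph V} {h m ℓ : ℕ} {z p v : V} {l : List V}
    {F : ℕ → Set V} (H : G.IsBroom h m ℓ z l F) {i : ℕ} (hi : i < m)
    (hvF : ∃ a ∈ F i, G.Adj v a) (hvz : v ≠ z) (hpF : p ∉ F i) (hpa : ∀ a ∈ F i, ¬ G.Adj p a)
    (hpv : G.Adj p v) : G.LinkedBy z p (insert v (F i)) := by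
  obtain ⟨a, ha, hva⟩ := hvF
  obtain ⟨x, hx, hzx⟩ := H.adj i hi
  exact
    { conn := (H.conn i hi).insert ha hva
      left_notMem := fun h => (Set.mem_insert_iff.1 h).elim (fun h => hvz h.symm) (H.notMem i hi)
      right_notMem := fun h => (Set.mem_insert_iff.1 h).elim (fun h => hpv.ne h) hpF
      left_adj := ⟨x, Set.mem_insert_of_mem _ hx, hzx⟩
      right_adj := ⟨v, Set.mem_insert _ _, hpv⟩
      ne := ⟨x, Set.mem_insert_of_mem _ hx, fun h => hpa x hx (h.1 hzx)⟩ }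

theorem IsBroom.not_adj_insert {G : SimpleGraph V} {h m ℓ : ℕ} {z : V} {l : List V}
    {F : ℕ → Set V} {v : ℕ → V} (H : G.IsBroom h m ℓ z l F)
    (hv : ∀ i < m, ∀ j < m, i ≠ j → ∀ a ∈ F j, ¬ G.Adj (v i) a)
    (hvv : ∀ i < m, ∀ j < m, i ≠ j → ¬ G.Adj (v i) (v j)) :
    ∀ i < m, ∀ j < m, i ≠ j → ∀ a ∈ insert (v i) (F i), ∀ b ∈ insert (v j) (F j),
      ¬ G.Adj a b := by
  rintro i hi j hj hij a (rfl | ha) b (rfl | hb)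
  · exact hvv i hi j hj hij
  · exact hv i hi j hj hij b hb
  · exact fun h => hv j hj i hi hij.symm a ha h.symm
  · exact (H.disj i hi j hj hij a ha b hb).2

/-! ### Enlarging the fibers by uniformly attached vertices -/

/-- The handle has fewer than `c + 1` vertices, so many `v i` either all miss `l` or share a
neighbor on it. In the first case each `F i` absorbs `v i`. In the second, `z` and the shared
neighbor are linked by the sets `insert (v i) (F i)`, which is impossible for `c + 1` of them. -/
theorem exists_fibers_card_succ_of_stable (c w : ℕ) : ∃ m, ∀ (V : Type u) [Finite V]
    (G : SimpleGraph V), G.AvoidsPathAndMatchedCliques c → ∀ (h ℓ : ℕ) (z : V) (l : List V)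
    (F : ℕ → Set V) (v : ℕ → V) (δ : Prop), G.IsBroom h m ℓ z l F →
    G.IsAttached m z l F v False False False δ → G.HasBroom h w (ℓ + 1) := by
  classical
  obtain ⟨m, hm⟩ := exists_subsequence_of_finite (Option (Fin c)) (max (c + 1) w)
  refine ⟨m, fun V _ G hG h ℓ z l F v δ H A => ?_⟩
  have hl : l.length < c := by
    have := H.path.length_lt hG
    simp at this; omega
  have hf : ∀ i, ∃ o : Option (Fin c), (o = none ∧ ∀ u ∈ l, ¬ G.Adj u (v i)) ∨
      ∃ k, o = some k ∧ ∃ hk : k.1 < l.length, G.Adj l[k.1] (v i) := by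
    intro i
    by_cases hi : ∀ u ∈ l, ¬ G.Adj u (v i)
    · exact ⟨none, .inl ⟨rfl, hi⟩⟩
    · push Not at hi
      obtain ⟨u, hu, huv⟩ := hi
      obtain ⟨k, hk, rfl⟩ := List.getElem_of_mem hu
      exact ⟨some ⟨k, hk.trans hl⟩, .inr ⟨_, rfl, hk, huv⟩⟩
  choose f hf using hf
  obtain ⟨g, hg, hgm, o, ho⟩ := hm f
  have hgne := ne_of_strictMono hg
  have hB := H.comp_strictMono g hgm hg
  have hd := hB.not_adj_insert (v := fun i => v (g i))
    (fun i hi j hj hij a ha => A.not_adj (hgm i hi) (hgm j hj) (hgne i hi j hj hij) ha)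
    (fun i hi j hj hij => by simpa using (A.pair_ne (hgm i hi) (hgm j hj) (hgne i hi j hj hij)).2)
  rcases o with _ | k
  · refine ⟨z, l, fun i => insert (v (g i)) (F (g i)), H.path, H.length, fun i hi => ?_,
      fun i hi => ?_, fun i hi => ?_, fun i hi => ?_, fun i hi => ?_, fun i hi j hj hij => ?_⟩
    all_goals have hi' := hgm i (by omega)
    · rw [Set.ncard_insert_of_notMem (A.notMem _ hi' _ hi'), H.card _ hi']
    · obtain ⟨a, ha, hva⟩ := A.exists_adj hi'
      exact (H.conn _ hi').insert ha hva
    · obtain ⟨a, ha, hva⟩ := H.adj _ hi'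
      exact ⟨a, Set.mem_insert_of_mem _ ha, hva⟩
    · rintro (hz | hz)
      · exact (A.notMem_path _ hi').1 hz.symm
      · exact H.notMem _ hi' hz
    · rintro x (rfl | hx) u hu
      · have h2 : ∀ u ∈ l, ¬ G.Adj u (v (g i)) := by
          rcases hf (g i) with h1 | ⟨k, h1, -⟩
          · exact h1.2
          · rw [ho i (by omega)] at h1; simp at h1
        exact ⟨fun h => (A.notMem_path _ hi').2 (h ▸ hu), fun h => h2 u hu h.symm⟩
      · exact H.tail _ hi' x hx u hu
    · intro a ha b hb
      refine ⟨?_, hd i (by omega) j (by omega) hij a ha b hb⟩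
      have hj' := hgm j (by omega)
      have hne := hgne i (by omega) j (by omega) hij
      rcases ha with rfl | ha <;> rcases hb with rfl | hb
      · exact (A.pair_ne hi' hj' hne).1
      · exact fun h => A.notMem _ hi' _ hj' (h ▸ hb)
      · exact fun h => A.notMem _ hj' _ hi' (h ▸ ha)
      · exact (H.disj _ hi' _ hj' hne a ha b hb).1
  · have hp : ∀ i < max (c + 1) w, ∃ hk : k.1 < l.length, G.Adj l[k.1] (v (g i)) := by
      intro i hi
      rcases hf (g i) with h1 | ⟨k', h1, h2⟩
      · rw [ho i hi] at h1; simp at h1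
      · rw [ho i hi] at h1
        obtain rfl : k = k' := by simpa using h1
        exact h2
    obtain ⟨hk, -⟩ := hp 0 (by omega)
    have hkl : l[k.1] ∈ l := List.getElem_mem hk
    refine (hG.false_of_linkedBy (z := z) (v := l[k.1])
      (F := fun i => insert (v (g i)) (F (g i))) (H.path.head_ne _ hkl).symm
      (fun i hi j hj hij => hd i (by omega) j (by omega) hij) (fun i hi => ?_)).elim
    have hi' := hgm i (by omega)
    exact H.linkedBy_insert hi' (A.exists_adj hi') (A.notMem_path _ hi').1
      (fun h => (H.tail _ hi' _ h _ hkl).1 rfl) (fun a ha h => (H.tail _ hi' a ha _ hkl).2 h.symm)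
      (hp i (by omega)).2

/-- Complementing at `v 0` makes the other `v i` pairwise nonadjacent and leaves their fibers alone.
Then `z` and `v 0` are linked by the `c + 1` remaining sets `insert (v i) (F i)`. -/
theorem IsAttached.false_of_clique {G : SimpleGraph V} {c : ℕ}
    (hG : G.AvoidsPathAndMatchedCliques c) {h ℓ : ℕ} {z : V} {l : List V}
    {F : ℕ → Set V} {v : ℕ → V} {δ : Prop} (H : G.IsBroom h (c + 2) ℓ z l F)
    (A : G.IsAttached (c + 2) z l F v False False True δ) : False := by
  have h0 : ∀ i < c + 1, ∀ a ∈ F (i + 1), ¬ G.Adj (v 0) a := fun i hi a ha =>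
    A.not_adj (by omega) (by omega) (by omega) ha
  have hF : ∀ i < c + 1, ∀ a ∈ F (i + 1), ∀ b,
      (G.localComplement (v 0)).Adj a b ↔ G.Adj a b := fun i hi a ha b =>
    localComplement_adj_of_not (h0 i hi a ha)
  have hF' : ∀ i < c + 1, ∀ a ∈ F (i + 1), ∀ b,
      (G.localComplement (v 0)).Adj b a ↔ G.Adj b a := fun i hi a ha b =>
    localComplement_adj_of_not' (h0 i hi a ha)
  have hv : ∀ i < c + 1, G.Adj (v 0) (v (i + 1)) := fun i hi =>
    (A.pair 0 (i + 1) (by omega) (by omega)).2.2 trivial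
  have hvv : ∀ i < c + 1, ∀ j < c + 1, i ≠ j →
      ¬ (G.localComplement (v 0)).Adj (v (i + 1)) (v (j + 1)) := fun i hi j hj hij => by
    have := A.pair_ne (i := i + 1) (j := j + 1) (by omega) (by omega) (by omega)
    rw [localComplement_adj this.1]
    simp [hv i hi, hv j hj, this.2]
  refine (hG.of_locallyEquivalent (locallyEquivalent_localComplement G (v 0))).false_of_linkedBy
    (z := z) (v := v 0) (F := fun i => insert (v (i + 1)) (F (i + 1)))
    (A.notMem_path 0 (by omega)).1.symm ?_ ?_
  · rintro i hi j hj hij a (rfl | ha) b (rfl | hb)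
    · exact hvv i hi j hj hij
    · rw [hF' j hj b hb]
      exact A.not_adj (by omega) (by omega) (by omega) hb
    · rw [hF i hi a ha, adj_comm]
      exact A.not_adj (by omega) (by omega) (by omega) ha
    · rw [hF i hi a ha]
      exact (H.disj _ (by omega) _ (by omega) (by omega) a ha b hb).2
  · intro i hi
    have L := H.linkedBy_insert (i := i + 1) (by omega) (A.exists_adj (by omega))
      (A.notMem_path (i + 1) (by omega)).1 (A.notMem 0 (by omega) _ (by omega)) (h0 i hi) (hv i hi)
    obtain ⟨a, ha, hva⟩ := A.exists_adj (i := i + 1) (by omega)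
    obtain ⟨x, hx, hzx⟩ := H.adj (i + 1) (by omega)
    exact
      { conn := ((H.conn (i + 1) (by omega)).congr
          fun a ha b _ h => (hF i hi a ha b).2 h).insert ha ((hF' i hi a ha _).2 hva)
        left_notMem := L.left_notMem
        right_notMem := L.right_notMem
        left_adj := ⟨x, Set.mem_insert_of_mem _ hx, (hF' i hi x hx z).2 hzx⟩
        right_adj := ⟨v (i + 1), Set.mem_insert _ _, localComplement_adj_self.2 (hv i hi)⟩
        ne := ⟨x, Set.mem_insert_of_mem _ hx, fun h => h0 i hi x hx
          (localComplement_adj_self.1 (h.1 ((hF' i hi x hx z).2 hzx)))⟩ }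

/-- Pivoting at an edge between the center and a fiber complements the adjacencies between the
attached vertices and the neighbors of the center in the other fibers. -/
theorem IsAttached.exists_pivot {G : SimpleGraph V} {m h ℓ : ℕ} {z : V} {l : List V}
    {F : ℕ → Set V} {v : ℕ → V} {γ δ : Prop} (H : G.IsBroom h (m + 1) ℓ z l F)
    (A : G.IsAttached (m + 1) z l F v True True γ δ) :
    ∃ x G', G.LocallyEquivalent G' ∧ G'.IsBroom h m ℓ x l (fun i => F (i + 1)) ∧
      G'.IsAttached m x l (fun i => F (i + 1)) (fun i => v (i + 1)) False False γ δ := by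
  -- The pivot exchanges the neighborhoods of `z` and `x`, so `x` becomes the center. It misses `l`
  -- and the other fibers, which therefore keep their edges, and it is adjacent to every later `v i`
  -- because `β` is true.
  obtain ⟨x, hx, hzx⟩ := H.adj 0 (by omega)
  have hxl : ∀ u ∈ l, u ≠ z ∧ u ≠ x ∧ ¬ G.Adj x u := fun u hu =>
    ⟨H.path.head_ne u hu, (H.tail 0 (by omega) x hx u hu).1.symm,
      (H.tail 0 (by omega) x hx u hu).2⟩
  have hxF : ∀ i < m, ∀ a ∈ F (i + 1), a ≠ z ∧ a ≠ x ∧ ¬ G.Adj x a := fun i hi a ha => by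
    have := H.disj 0 (by omega) (i + 1) (by omega) (by omega) x hx a ha
    exact ⟨fun h => H.notMem (i + 1) (by omega) (h ▸ ha), this.1.symm, this.2⟩
  have hxv : ∀ i < m, v (i + 1) ≠ z ∧ v (i + 1) ≠ x ∧ G.Adj x (v (i + 1)) := fun i hi =>
    ⟨(A.notMem_path _ (by omega)).1, fun h => A.notMem (i + 1) (by omega) 0 (by omega) (h ▸ hx),
      ((A.earlier 0 (i + 1) (by omega) (by omega) x hx).2 ⟨trivial, hzx⟩).symm⟩
  have hold : ∀ a b, a ≠ z → a ≠ x → ¬ G.Adj x a → b ≠ z → b ≠ x → ¬ G.Adj x b →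
      ((G.pivot z x).Adj a b ↔ G.Adj a b) := fun a b h1 h2 h3 h4 h5 h6 => by
    by_cases hab : a = b
    · subst hab; simp
    · rw [pivot_adj hzx h1 h2 h4 h5 hab]; simp [h3, h6]
  have hnew : ∀ i < m, ∀ j < m, ∀ a ∈ F (j + 1), ((G.pivot z x).Adj (v (i + 1)) a ↔
      ¬ (G.Adj (v (i + 1)) a ↔ G.Adj z a)) := fun i hi j hj a ha => by
    obtain ⟨h1, h2, h3⟩ := hxv i hi
    obtain ⟨h4, h5, h6⟩ := hxF j hj a ha
    rw [pivot_adj hzx h1 h2 h4 h5 (fun h => A.notMem (i + 1) (by omega) (j + 1) (by omega) (h ▸ ha))]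
    simp only [h3, h6]; tauto
  have hpath : ∀ l' : List V, (∀ u ∈ l', u ∈ l) → G.IsInducedPathList l' →
      (G.pivot z x).IsInducedPathList l' := by
    intro l'
    induction l' with
    | nil => intros; trivial
    | cons a t ih =>
      intro hsub hp
      cases t with
      | nil => trivial
      | cons b t =>
        have e := fun u hu => hold a u (hxl a (hsub a (by simp))).1 (hxl a (hsub a (by simp))).2.1
          (hxl a (hsub a (by simp))).2.2 (hxl u (hsub u hu)).1 (hxl u (hsub u hu)).2.1
          (hxl u (hsub u hu)).2.2
        exact ⟨(e b (by simp)).2 hp.1, fun u hu => ⟨fun h => (hp.2.1 u hu).1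
          ((e u (by simp [hu])).1 h), (hp.2.1 u hu).2⟩,
          ih (fun u hu => hsub u (by simp_all)) hp.2.2⟩
  refine ⟨x, G.pivot z x, locallyEquivalent_pivot _ _ _, ?_, ?_⟩
  · refine ⟨?_, H.length, fun i hi => H.card _ (by omega), fun i hi => ?_, fun i hi => ?_,
      fun i hi h => (hxF i hi x h).2.1 rfl, fun i hi a ha u hu => ?_, fun i hi j hj hij a ha b hb => ?_⟩
    · have hp := hpath l (fun _ h => h) H.path.tail
      have hP := H.path
      cases l with
      | nil => trivial
      | cons y t =>
        have e := fun u hu => pivot_adj_right hzx (hxl u hu).1 (hxl u hu).2.1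
        exact ⟨(e y (by simp)).2 hP.1, fun u hu => ⟨fun h => (hP.2.1 u hu).1
          ((e u (by simp [hu])).1 h), (hxl u (by simp [hu])).2.1⟩, hp⟩
    · refine (H.conn (i + 1) (by omega)).congr fun a ha b hb hab => ?_
      obtain ⟨h1, h2, h3⟩ := hxF i hi a ha
      obtain ⟨h4, h5, h6⟩ := hxF i hi b hb
      exact (hold a b h1 h2 h3 h4 h5 h6).2 hab
    · obtain ⟨a, ha, hza⟩ := H.adj (i + 1) (by omega)
      exact ⟨a, ha, (pivot_adj_right hzx (hxF i hi a ha).1 (hxF i hi a ha).2.1).2 hza⟩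
    · obtain ⟨h1, h2, h3⟩ := hxF i hi a ha
      obtain ⟨h4, h5, h6⟩ := hxl u hu
      rw [hold a u h1 h2 h3 h4 h5 h6]
      exact H.tail _ (by omega) a ha u hu
    · obtain ⟨h1, h2, h3⟩ := hxF i hi a ha
      obtain ⟨h4, h5, h6⟩ := hxF j hj b hb
      rw [hold a b h1 h2 h3 h4 h5 h6]
      exact H.disj _ (by omega) _ (by omega) (by omega) a ha b hb
  · refine ⟨fun i hi => ⟨(hxv i hi).2.1, (A.notMem_path _ (by omega)).2⟩,
      fun i hi j hj => A.notMem _ (by omega) _ (by omega), fun i j hij hj a ha => ?_,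
      fun i j hij hj a ha => ?_, fun i j hij hj => ?_, fun i hi => ?_, fun _ i hi => ?_⟩
    · rw [hnew i (by omega) j hj a ha,
        A.later (i + 1) (j + 1) (by omega) (by omega) a ha]
      tauto
    · rw [hnew j (by omega) i (by omega) a ha,
        A.earlier (i + 1) (j + 1) (by omega) (by omega) a ha]
      tauto
    · have := A.pair (i + 1) (j + 1) (by omega) (by omega)
      refine ⟨this.1, ?_⟩
      obtain ⟨h1, h2, h3⟩ := hxv i (by omega)
      obtain ⟨h4, h5, h6⟩ := hxv j (by omega)
      rw [pivot_adj hzx h1 h2 h4 h5 this.1, this.2, A.center (i + 1) (by omega),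
        A.center (j + 1) (by omega)]
      simp [h3, h6]
    · rw [pivot_adj_right hzx (hxv i hi).1 (hxv i hi).2.1]
      exact A.center (i + 1) (by omega)
    · obtain ⟨a, ha, hne⟩ := A.own Iff.rfl (i + 1) (by omega)
      refine ⟨a, ha, ?_⟩
      rw [hnew i hi i hi a ha]
      tauto

theorem IsAttached.mono {G : SimpleGraph V} {m n : ℕ} {z : V} {l : List V}
    {F : ℕ → Set V} {v : ℕ → V} {α β γ δ : Prop} (A : G.IsAttached m z l F v α β γ δ)
    (hn : n ≤ m) : G.IsAttached n z l F v α β γ δ where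
  notMem_path i hi := A.notMem_path i (by omega)
  notMem i hi j hj := A.notMem i (by omega) j (by omega)
  later i j hij hj := A.later i j hij (by omega)
  earlier i j hij hj := A.earlier i j hij (by omega)
  pair i j hij hj := A.pair i j hij (by omega)
  center i hi := A.center i (by omega)
  own h i hi := A.own h i (by omega)

theorem IsBroom.mono {G : SimpleGraph V} {h m n ℓ : ℕ} {z : V} {l : List V}
    {F : ℕ → Set V} (H : G.IsBroom h m ℓ z l F) (hn : n ≤ m) : G.IsBroom h n ℓ z l F :=
  H.comp id (fun i hi => by simp; omega) (fun _ _ _ _ h => h)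

/-- If `α` and `β` differ, the `v i` and chosen neighbors of `z` in the fibers form a half graph. If
both hold, a pivot makes both fail. If both fail, the `v i` cannot be a clique, and as a stable set
they enlarge the fibers. -/
theorem exists_fibers_card_succ_of_isAttached (c w : ℕ) : ∃ m, ∀ (V : Type u) [Finite V]
    (G : SimpleGraph V), G.AvoidsPathAndMatchedCliques c → ∀ (h ℓ : ℕ) (z : V) (l : List V)
    (F : ℕ → Set V) (v : ℕ → V) (α β γ δ : Prop), G.IsBroom h m ℓ z l F →
    G.IsAttached m z l F v α β γ δ → ∃ G', G.LocallyEquivalent G' ∧ G'.HasBroom h w (ℓ + 1) := by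
  obtain ⟨m, hm⟩ := exists_fibers_card_succ_of_stable.{u} c w
  have key : ∀ (V : Type u) [Finite V] (G : SimpleGraph V), G.AvoidsPathAndMatchedCliques c →
      ∀ (h ℓ : ℕ) (z : V) (l : List V) (F : ℕ → Set V) (v : ℕ → V) (γ δ : Prop),
      G.IsBroom h (m + (c + 2)) ℓ z l F → G.IsAttached (m + (c + 2)) z l F v False False γ δ →
      G.HasBroom h w (ℓ + 1) := by
    intro V _ G hG h ℓ z l F v γ δ H A
    by_cases hγ : γ
    · simp only [hγ] at A
      exact ((A.mono (n := c + 2) (by omega)).false_of_clique hG (H.mono (by omega))).elim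
    · simp only [hγ] at A
      exact hm V G hG h ℓ z l F v δ (H.mono (by omega)) (A.mono (by omega))
  -- The summands pay for the stable case, the clique case, the fiber used up by the pivot, and the
  -- half graph.
  refine ⟨m + (c + 2) + 1 + (2 * c + 4), fun V _ G hG h ℓ z l F v α β γ δ H A => ?_⟩
  by_cases hαβ : α ↔ β
  · by_cases hα : α
    · have hβ := hαβ.1 hα
      simp only [hα, hβ] at A
      obtain ⟨x, G', hG', H', A'⟩ :=
        (A.mono (n := m + (c + 2) + 1) (by omega)).exists_pivot (H.mono (by omega))
      exact ⟨G', hG', key V G' (hG.of_locallyEquivalent hG') _ _ _ _ _ _ _ _ H' A'⟩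
    · have hβ : ¬ β := fun h => hα (hαβ.2 h)
      simp only [hα, hβ] at A
      exact ⟨G, .refl G, key V G hG _ _ _ _ _ _ _ _ (H.mono (by omega)) (A.mono (by omega))⟩
  · have : Nonempty V := ⟨z⟩
    choose! x hxF hzx using H.adj
    refine (hG.false_of_halfGraph (v := v) (x := x) (α := α) (γ := γ) fun i j hij hj => ?_).elim
    have hi' := hxF i (by omega)
    have hj' := hxF j (by omega)
    have h1 := H.disj i (by omega) j (by omega) hij.ne _ hi' _ hj'
    have h2 := A.pair i j hij (by omega)
    refine ⟨h2.1, h1.1, fun h => A.notMem i (by omega) j (by omega) (h ▸ hj'),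
      fun h => A.notMem j (by omega) i (by omega) (h ▸ hi'), ?_, ?_, h1.2, h2.2⟩
    · rw [A.later i j hij (by omega) _ hj']
      simp [hzx j (by omega)]
    · rw [A.earlier i j hij (by omega) _ hi']
      simp only [hzx i (by omega), and_true]
      tauto

/-! ### Attached vertices from primeness -/

/-- If every outside vertex saw in `A` either nothing or exactly `A₀`, then `A` and its complement
would form a split. -/
theorem IsSplitPrime.exists_nontrivial_row {G : SimpleGraph V} (hG : G.IsSplitPrime) {A A₀ : Set V}
    (hA : A.Nontrivial) (hA' : Aᶜ.Nontrivial) (hA₀ : A₀ ⊆ A) :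
    ∃ v ∉ A, (∃ a ∈ A, G.Adj v a) ∧ ∃ a ∈ A, ¬ (G.Adj v a ↔ a ∈ A₀) := by
  by_contra! hcon
  refine hG A Aᶜ ⟨disjoint_compl_right, Set.union_compl_self A, hA, hA', A₀, hA₀,
    {v | v ∈ Aᶜ ∧ ∃ a ∈ A, G.Adj v a}, fun v hv => hv.1, fun a ha b hb => ?_⟩
  constructor
  · intro hab
    exact ⟨(hcon b hb ⟨a, ha, hab.symm⟩ a ha).1 hab.symm, hb, a, ha, hab.symm⟩
  · rintro ⟨ha₀, -, h⟩
    exact ((hcon b hb h a ha).2 ha₀).symm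

/-- Primeness, applied to `F i` and the neighbors of `z` in it, gives `v i` whose trace on `F i` is
neither empty nor that of `z`. By Ramsey's theorem the behavior on later and on earlier fibers is
uniform. A single vertex whose trace is neither empty nor that of `z` on `c + 1` fibers would be
linked to `z` through them; so the `v i` are distinct, and on the other fibers their traces are
empty or copy `z`. -/
theorem exists_uniform_of_large_fibers (c M : ℕ) : ∃ W, ∀ (V : Type u) [Finite V]
    (G : SimpleGraph V), G.IsSplitPrime → G.AvoidsPathAndMatchedCliques c →
    ∀ (h ℓ : ℕ) (z : V) (l : List V) (F : ℕ → Set V), 2 ≤ ℓ → G.IsBroom h W ℓ z l F →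
    ∃ F' v α β γ δ, G.IsBroom h M ℓ z l F' ∧ G.IsAttached M z l F' v α β γ δ := by
  classical
  obtain ⟨W, hW⟩ := exists_homogeneous_subsequence
    (Prop × Prop × Prop × Prop × Prop × Prop × Prop) (M + c + 3)
  refine ⟨W + 2, fun V _ G hp hG h ℓ z l F hℓ H => ?_⟩
  have hv : ∀ i, ∃ v, i < W + 2 → v ∉ F i ∧ (∃ a ∈ F i, G.Adj v a) ∧
      ∃ a ∈ F i, ¬ (G.Adj v a ↔ G.Adj z a) := by
    intro i
    by_cases hi : i < W + 2
    · have hnt : (F i).Nontrivial := by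
        have := H.card i hi
        exact Set.one_lt_ncard_iff_nontrivial.1 (by omega)
      obtain ⟨j, hj, hij⟩ : ∃ j < W + 2, i ≠ j := by
        rcases i with _ | i
        · exact ⟨1, by omega, by omega⟩
        · exact ⟨0, by omega, by omega⟩
      obtain ⟨b, hb, -⟩ := H.adj j hj
      -- A second fiber supplies a vertex other than `z` outside `F i`; this is why at least two
      -- fibers are kept.
      have hnt' : (F i)ᶜ.Nontrivial := ⟨z, H.notMem i hi, b,
        fun h => (H.disj i hi j hj hij b h b hb).1 rfl, fun h => H.notMem j hj (h ▸ hb)⟩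
      obtain ⟨v, h1, h2, a, ha, h3⟩ := hp.exists_nontrivial_row hnt hnt'
        (A₀ := {a | a ∈ F i ∧ G.Adj z a}) (fun a ha => ha.1)
      exact ⟨v, fun _ => ⟨h1, h2, a, ha, fun h => h3 (h.trans ⟨fun h => ⟨ha, h⟩, fun h => h.2⟩)⟩⟩
    · exact ⟨z, fun h => (hi h).elim⟩
  choose v hv using hv
  have hvz : ∀ i < W + 2, v i ≠ z := fun i hi hz => by
    obtain ⟨a, ha, hne⟩ := (hv i hi).2.2
    exact hne (by rw [hz])
  have hvl : ∀ i < W + 2, v i ∉ l := fun i hi hl => by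
    obtain ⟨a, ha, hva⟩ := (hv i hi).2.1
    exact (H.tail i hi a ha _ hl).2 hva.symm
  have hvF : ∀ i < W + 2, ∀ j < W + 2, v i ∉ F j := fun i hi j hj h => by
    by_cases hij : i = j
    · subst hij; exact (hv i hi).1 h
    · obtain ⟨a, ha, hva⟩ := (hv i hi).2.1
      exact (H.disj i hi j hj hij a ha _ h).2 hva.symm
  obtain ⟨g, hg, hgW, ⟨k1, k2, k3, k4, k5, k6, k7⟩, hk⟩ := hW fun i j =>
    (v i = v j, (∀ a ∈ F j, ¬ G.Adj (v i) a), (∀ a ∈ F j, (G.Adj (v i) a ↔ G.Adj z a)),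
      (∀ a ∈ F i, ¬ G.Adj (v j) a), (∀ a ∈ F i, (G.Adj (v j) a ↔ G.Adj z a)),
      G.Adj (v i) (v j), G.Adj z (v i))
  simp only [Prod.mk.injEq, eq_iff_iff] at hk
  have hgW' : ∀ i < M + c + 3, g i < W + 2 := fun i hi => (hgW i hi).trans (by omega)
  have hgne := ne_of_strictMono hg
  have B := H.comp_strictMono g hgW' hg
  -- a vertex attached nontrivially to many fibers
  have hmany : ∀ p, p ≠ z → (∀ j < M + c + 3, p ∉ F (g j)) → ∀ f : ℕ → ℕ,
      (∀ i < c + 1, f i < M + c + 3) → (∀ i < c + 1, ∀ j < c + 1, i ≠ j → f i ≠ f j) →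
      (∀ i < c + 1, (∃ a ∈ F (g (f i)), G.Adj p a) ∧
        ∃ a ∈ F (g (f i)), ¬ (G.Adj p a ↔ G.Adj z a)) → False := by
    intro p hpz hpF f hf hf' hadj
    refine hG.false_of_linkedBy (z := z) (v := p) (F := fun i => F (g (f i))) hpz.symm
      (fun i hi j hj hij a ha b hb =>
        (B.disj _ (hf i hi) _ (hf j hj) (hf' i hi j hj hij) a ha b hb).2)
      (fun i hi => ⟨B.conn _ (hf i hi), B.notMem _ (hf i hi), hpF _ (hf i hi), B.adj _ (hf i hi),
        (hadj i hi).1, ?_⟩)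
    obtain ⟨a, ha, hne⟩ := (hadj i hi).2
    exact ⟨a, ha, fun h => hne h.symm⟩
  have h1 : ¬ k1 := fun h1 => by
    refine hmany (v (g 0)) (hvz _ (hgW' _ (by omega)))
      (fun j hj => hvF _ (hgW' _ (by omega)) _ (hgW' _ hj)) (fun i => i)
      (fun i hi => by omega) (fun _ _ _ _ h => h) (fun i hi => ?_)
    have he : v (g 0) = v (g i) := by
      rcases i with _ | i
      · rfl
      · exact (hk 0 (i + 1) (by omega) (by omega)).1.2 h1
    rw [he]
    exact (hv _ (hgW' i (by omega))).2
  have h23 : k2 ∨ k3 := by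
    by_contra! hcon
    refine hmany (v (g 0)) (hvz _ (hgW' _ (by omega)))
      (fun j hj => hvF _ (hgW' _ (by omega)) _ (hgW' _ hj)) (fun i => i + 1)
      (fun i hi => by omega) (fun _ _ _ _ h => by omega) (fun i hi => ?_)
    have := hk 0 (i + 1) (by omega) (by omega)
    have e2 := this.2.1.not.2 hcon.1
    have e3 := this.2.2.1.not.2 hcon.2
    push Not at e2
    simp only [not_forall, exists_prop] at e3
    exact ⟨e2, e3⟩
  have h45 : k4 ∨ k5 := by
    by_contra! hcon
    refine hmany (v (g (c + 1))) (hvz _ (hgW' _ (by omega)))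
      (fun j hj => hvF _ (hgW' _ (by omega)) _ (hgW' _ hj)) (fun i => i)
      (fun i hi => by omega) (fun _ _ _ _ h => h) (fun i hi => ?_)
    have := hk i (c + 1) (by omega) (by omega)
    have e2 := this.2.2.2.1.not.2 hcon.1
    have e3 := this.2.2.2.2.1.not.2 hcon.2
    push Not at e2
    simp only [not_forall, exists_prop] at e3
    exact ⟨e2, e3⟩
  refine ⟨fun i => F (g i), fun i => v (g i), k3, k5, k6, k7, B.mono (by omega),
    fun i hi => ⟨hvz _ (hgW' _ (by omega)), hvl _ (hgW' _ (by omega))⟩,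
    fun i hi j hj => hvF _ (hgW' _ (by omega)) _ (hgW' _ (by omega)), fun i j hij hj a ha => ?_,
    fun i j hij hj a ha => ?_, fun i j hij hj => ?_, fun i hi => ?_, fun _ i hi => ?_⟩
  · have := hk i j hij (by omega)
    by_cases h3 : k3
    · simp only [h3, true_and]; exact this.2.2.1.2 h3 a ha
    · simp only [h3, false_and, iff_false]; exact this.2.1.2 (by tauto) a ha
  · have := hk i j hij (by omega)
    by_cases h5 : k5
    · simp only [h5, true_and]; exact this.2.2.2.2.1.2 h5 a ha
    · simp only [h5, false_and, iff_false]; exact this.2.2.2.1.2 (by tauto) a ha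
  · have := hk i j hij (by omega)
    exact ⟨fun h => h1 (this.1.1 h), this.2.2.2.2.2.1⟩
  · exact (hk i (i + 1) (by omega) (by omega)).2.2.2.2.2.2
  · by_cases h3 : k3
    · simpa [h3] using (hv _ (hgW' i (by omega))).2.2
    · simpa [h3] using (hv _ (hgW' i (by omega))).2.1

/-- From many vertices with pairwise different neighborhoods, choose a sequence of them together
with vertices each of which separates one from all the later ones. -/
theorem exists_separating_sequence (n : ℕ) : ∃ N, ∀ (V : Type u) (G : SimpleGraph V) (x : ℕ → V)
    (X : Finset ℕ), N ≤ X.card → (∀ a ∈ X, ∀ b ∈ X, a ≠ b → ∃ y, ¬ (G.Adj y (x a) ↔ G.Adj y (x b))) →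
    ∃ (g : ℕ → ℕ) (y : ℕ → V), (∀ i < n, g i ∈ X) ∧
      ∀ i j, i < j → j < n → g i ≠ g j ∧ ¬ (G.Adj (y i) (x (g i)) ↔ G.Adj (y i) (x (g j))) := by
  classical
  induction n with
  | zero => exact ⟨0, fun V G x X _ _ => ⟨fun _ => 0, fun _ => x 0, by simp, by simp⟩⟩
  | succ n ih =>
    obtain ⟨N, hN⟩ := ih
    refine ⟨2 * N + 2, fun V G x X hX hsep => ?_⟩
    obtain ⟨a, ha, b, hb, hab⟩ := Finset.one_lt_card.1 (show 1 < X.card by omega)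
    obtain ⟨y, hy⟩ := hsep a ha b hb hab
    -- The vertex `y` divides `X` into two classes. One of them has at least `N` elements; `p` is
    -- taken from the other class and becomes the first term.
    have key : ∀ p ∈ X, ∀ Y ⊆ X, N ≤ Y.card →
        (∀ q ∈ Y, ¬ (G.Adj y (x p) ↔ G.Adj y (x q))) →
        ∃ (g : ℕ → ℕ) (y : ℕ → V), (∀ i < n + 1, g i ∈ X) ∧ ∀ i j, i < j → j < n + 1 →
          g i ≠ g j ∧ ¬ (G.Adj (y i) (x (g i)) ↔ G.Adj (y i) (x (g j))) := by
      intro p hp Y hYX hY hpq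
      obtain ⟨g, y', hg, hg'⟩ := hN V G x Y hY fun a ha b hb => hsep a (hYX ha) b (hYX hb)
      refine ⟨fun i => if i = 0 then p else g (i - 1), fun i => if i = 0 then y else y' (i - 1),
        fun i hi => ?_, fun i j hij hj => ?_⟩
      · rcases i with _ | i
        · simpa using hp
        · simpa using hYX (hg i (by omega))
      · obtain ⟨j, rfl⟩ : ∃ k, j = k + 1 := ⟨j - 1, by omega⟩
        rcases i with _ | i
        · have := hpq _ (hg j (by omega))
          simp only [if_true, Nat.add_one_ne_zero, if_false, Nat.add_sub_cancel]
          exact ⟨fun h => this (by rw [h]), this⟩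
        · simpa using hg' i j (by omega) (by omega)
    have hcard := Finset.card_filter_add_card_filter_not (s := X) (fun q => G.Adj y (x q))
    have hmem : ∀ p ∈ X, ∃ q ∈ X, ¬ (G.Adj y (x p) ↔ G.Adj y (x q)) := fun p hp => by
      by_cases h : G.Adj y (x p) ↔ G.Adj y (x a)
      · exact ⟨b, hb, by tauto⟩
      · exact ⟨a, ha, h⟩
    obtain ⟨p, hp, hpy⟩ : ∃ p ∈ X, G.Adj y (x p) := by
      by_cases h : G.Adj y (x a)
      · exact ⟨a, ha, h⟩
      · exact ⟨b, hb, by tauto⟩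
    obtain ⟨q, hq, hqy⟩ := hmem p hp
    rcases Nat.lt_or_ge (X.filter fun q => G.Adj y (x q)).card N with hlt | hge
    · refine key p hp _ (Finset.filter_subset (fun q => ¬ G.Adj y (x q)) X) (by omega) ?_
      intro r hr
      have := (Finset.mem_filter.1 hr).2
      tauto
    · refine key q hq _ (Finset.filter_subset (fun q => G.Adj y (x q)) X) hge ?_
      intro r hr
      have := (Finset.mem_filter.1 hr).2
      tauto

/-- A single vertex cannot be a side of a split, so primeness is applied to pairs of leaves: any two
are separated by some vertex. In a separating sequence, `y i` treats its own leaf opposite to all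
later ones, so once Ramsey's theorem has fixed the former as `k1`, the latter gives `α = ¬ k1`. -/
theorem exists_uniform_of_singleton_fibers (M : ℕ) : ∃ W, ∀ (V : Type u) [Finite V]
    (G : SimpleGraph V), G.IsSplitPrime → ∀ (h : ℕ) (z : V) (l : List V) (F : ℕ → Set V),
    G.IsBroom h W 1 z l F →
    ∃ F' v α β γ δ, G.IsBroom h M 1 z l F' ∧ G.IsAttached M z l F' v α β γ δ := by
  classical
  obtain ⟨N, hN⟩ := exists_homogeneous_subsequence (Prop × Prop × Prop × Prop) (M + 1)
  obtain ⟨W, hW⟩ := exists_separating_sequence.{u} (N + 1)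
  refine ⟨W + 3, fun V _ G hp h z l F H => ?_⟩
  have hx : ∀ i, ∃ x, i < W + 3 → F i = {x} := fun i => by
    by_cases hi : i < W + 3
    · obtain ⟨x, hx⟩ := Set.ncard_eq_one.1 (H.card i hi)
      exact ⟨x, fun _ => hx⟩
    · exact ⟨z, fun h => (hi h).elim⟩
  choose x hx using hx
  have hxF : ∀ i < W + 3, x i ∈ F i := fun i hi => by rw [hx i hi]; rfl
  have hzx : ∀ i < W + 3, G.Adj z (x i) := fun i hi => by
    obtain ⟨a, ha, hza⟩ := H.adj i hi
    rw [hx i hi] at ha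
    obtain rfl : a = x i := ha
    exact hza
  have hxx : ∀ i < W + 3, ∀ j < W + 3, i ≠ j → x i ≠ x j ∧ ¬ G.Adj (x i) (x j) :=
    fun i hi j hj hij => H.disj i hi j hj hij _ (hxF i hi) _ (hxF j hj)
  have hxx' : ∀ i < W + 3, ∀ j < W + 3, ¬ G.Adj (x i) (x j) := fun i hi j hj => by
    by_cases hij : i = j
    · subst hij; simp
    · exact (hxx i hi j hj hij).2
  obtain ⟨g, y, hgX, hg⟩ := hW V G x (Finset.range (W + 3)) (by simp) (by
    intro a ha b hb hab
    have ha' := Finset.mem_range.1 ha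
    have hb' := Finset.mem_range.1 hb
    -- A third leaf and `z` make the complement of the pair nontrivial.
    obtain ⟨k, hk, hka, hkb⟩ : ∃ k < W + 3, k ≠ a ∧ k ≠ b := by
      by_contra! hcon
      have h0 := hcon 0 (by omega)
      have h1 := hcon 1 (by omega)
      have h2 := hcon 2 (by omega)
      omega
    obtain ⟨v, -, ⟨p, hp, hvp⟩, q, hq, hvq⟩ := hp.exists_nontrivial_row
      (A := {x a, x b}) (A₀ := {x a, x b}) ⟨x a, by simp, x b, by simp, (hxx a ha' b hb' hab).1⟩
      ⟨z, by simp [(hzx a ha').ne, (hzx b hb').ne], x k,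
        by simp [(hxx k hk a ha' hka).1, (hxx k hk b hb' hkb).1], (hzx k hk).ne⟩ subset_rfl
    refine ⟨v, fun hiff => ?_⟩
    simp only [hq, iff_true] at hvq
    rcases hp with rfl | rfl <;> rcases hq with rfl | rfl <;> tauto)
  have hgX' : ∀ i < N + 1, g i < W + 3 := fun i hi => Finset.mem_range.1 (hgX i hi)
  have hyne : ∀ i < N, y i ≠ z ∧ y i ∉ l ∧ ∀ j < W + 3, y i ≠ x j := fun i hi => by
    have e := (hg i (i + 1) (by omega) (by omega)).2
    have e1 := hgX' i (by omega)
    have e2 := hgX' (i + 1) (by omega)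
    refine ⟨fun h => e ?_, fun h => e ?_, fun j hj h => e ?_⟩
    · rw [h]; exact iff_of_true (hzx _ e1) (hzx _ e2)
    · exact iff_of_false (fun h' => (H.tail _ e1 _ (hxF _ e1) _ h).2 h'.symm)
        (fun h' => (H.tail _ e2 _ (hxF _ e2) _ h).2 h'.symm)
    · rw [h]; exact iff_of_false (hxx' _ hj _ e1) (hxx' _ hj _ e2)
  -- For `i < j`, `y i` does not separate the leaves chosen at `j` and `j + 1`, whereas `y j` does.
  have hyy : ∀ i j, i < j → j < N → y i ≠ y j := fun i j hij hj h => by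
    have e1 := (hg j (j + 1) (by omega) (by omega)).2
    have e2 := (hg i j hij (by omega)).2
    have e3 := (hg i (j + 1) (by omega) (by omega)).2
    rw [← h] at e1
    tauto
  obtain ⟨s, hs, hsN, ⟨k1, k2, k3, k4⟩, hk⟩ := hN fun i j =>
    (G.Adj (y i) (x (g i)), G.Adj (y j) (x (g i)), G.Adj (y i) (y j), G.Adj z (y i))
  simp only [Prod.mk.injEq, eq_iff_iff] at hk
  have hgs : ∀ i < M + 1, g (s i) < W + 3 := fun i hi => hgX' _ (by have := hsN i hi; omega)
  have hsne := ne_of_strictMono hs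
  have hgne : ∀ i < N + 1, ∀ j < N + 1, i ≠ j → g i ≠ g j := fun i hi j hj hij => by
    rcases lt_or_gt_of_ne hij with h | h
    · exact (hg i j h hj).1
    · exact (hg j i h hi).1.symm
  have B := (H.comp g hgX' hgne).comp_strictMono s (fun i hi => (hsN i hi).trans (by omega)) hs
  have hF : ∀ i < M + 1, ∀ a ∈ F (g (s i)), a = x (g (s i)) := fun i hi a ha => by
    rw [hx _ (hgs i hi)] at ha; exact ha
  refine ⟨fun i => F (g (s i)), fun i => y (s i), ¬ k1, k2, k3, k4, B.mono (by omega),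
    fun i hi => ⟨(hyne _ (hsN i (by omega))).1, (hyne _ (hsN i (by omega))).2.1⟩,
    fun i hi j hj h => ?_, fun i j hij hj a ha => ?_,
    fun i j hij hj a ha => ?_, fun i j hij hj => ?_, fun i hi => ?_, fun hiff i hi => ?_⟩
  · exact (hyne _ (hsN i (by omega))).2.2 _ (hgs j (by omega)) (hF j (by omega) _ h)
  · obtain rfl := hF j (by omega) a ha
    have e1 := (hg (s i) (s j) (hs i j hij (by omega)) (by have := hsN j (by omega); omega)).2
    have e2 := (hk i j hij (by omega)).1
    have e3 := hzx _ (hgs j (by omega))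
    tauto
  · obtain rfl := hF i (by omega) a ha
    have e2 := (hk i j hij (by omega)).2.1
    have e3 := hzx _ (hgs i (by omega))
    tauto
  · exact ⟨hyy _ _ (hs i j hij (by omega)) (hsN j (by omega)), (hk i j hij (by omega)).2.2.1⟩
  · exact (hk i (i + 1) (by omega) (by omega)).2.2.2
  · have e2 := (hk i (i + 1) (by omega) (by omega)).1
    have e3 := hzx _ (hgs i (by omega))
    exact ⟨_, hxF _ (hgs i (by omega)), by tauto⟩

/-- In a prime graph, the fibers of a broom can be enlarged. -/
theorem exists_fibers_card_succ (c w ℓ : ℕ) (hℓ : 1 ≤ ℓ) : ∃ W, ∀ (V : Type u) [Finite V]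
    (G : SimpleGraph V), G.IsSplitPrime → G.AvoidsPathAndMatchedCliques c → ∀ h,
    G.HasBroom h W ℓ → ∃ G', G.LocallyEquivalent G' ∧ G'.HasBroom h w (ℓ + 1) := by
  obtain ⟨m, hm⟩ := exists_fibers_card_succ_of_isAttached.{u} c w
  rcases hℓ.eq_or_lt with rfl | hℓ
  · obtain ⟨W, hW⟩ := exists_uniform_of_singleton_fibers.{u} m
    refine ⟨W, fun V _ G hp hG h ⟨z, l, F, H⟩ => ?_⟩
    obtain ⟨F', v, α, β, γ, δ, H', A⟩ := hW V G hp h z l F H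
    exact hm V G hG _ _ _ _ _ _ _ _ _ _ H' A
  · obtain ⟨W, hW⟩ := exists_uniform_of_large_fibers.{u} c m
    refine ⟨W, fun V _ G hp hG h ⟨z, l, F, H⟩ => ?_⟩
    obtain ⟨F', v, α, β, γ, δ, H', A⟩ := hW V G hp hG h ℓ z l F hℓ H
    exact hm V G hG _ _ _ _ _ _ _ _ _ _ H' A

theorem exists_fibers_card_eq (c w ℓ : ℕ) : ∃ W, ∀ (V : Type u) [Finite V]
    (G : SimpleGraph V), G.IsSplitPrime → G.AvoidsPathAndMatchedCliques c → ∀ h,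
    G.HasBroom h W 1 → ∃ G', G.LocallyEquivalent G' ∧ G'.HasBroom h w (ℓ + 1) := by
  induction ℓ generalizing w with
  | zero => exact ⟨w, fun V _ G _ _ h H => ⟨G, .refl G, H⟩⟩
  | succ ℓ ih =>
    obtain ⟨W₁, hW₁⟩ := exists_fibers_card_succ.{u} c w (ℓ + 1) (by omega)
    obtain ⟨W, hW⟩ := ih W₁
    refine ⟨W, fun V _ G hp hG h H => ?_⟩
    obtain ⟨G', hG', H'⟩ := hW V G hp hG h H
    obtain ⟨G'', hG'', H''⟩ := hW₁ V G' (hp.of_locallyEquivalent hG')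
      (hG.of_locallyEquivalent hG') h H'
    exact ⟨G'', hG'.trans hG'', H''⟩

/-! ### Lengthening the handle -/

theorem hasBroom_of_leaves {G : SimpleGraph V} {h w : ℕ} {z : V} {l : List V} {x : ℕ → V}
    (hp : G.IsInducedPathList (z :: l)) (hh : h ≤ l.length + 1)
    (hz : ∀ i < w, G.Adj z (x i)) (hl : ∀ i < w, ∀ u ∈ l, x i ≠ u ∧ ¬ G.Adj (x i) u)
    (hx : ∀ i j, i < j → j < w → x i ≠ x j ∧ ¬ G.Adj (x i) (x j)) : G.HasBroom h w 1 := by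
  refine ⟨z, l, fun i => {x i}, hp, hh, fun i _ => Set.ncard_singleton _,
    fun i _ => G.connectedOn_singleton _, fun i hi => ⟨x i, rfl, hz i hi⟩,
    fun i hi h => (hz i hi).ne h, fun i hi a ha u hu => ?_, fun i hi j hj hij a ha b hb => ?_⟩
  · obtain rfl : a = x i := ha
    exact hl i hi u hu
  · obtain rfl : a = x i := ha
    obtain rfl : b = x j := hb
    rcases lt_or_gt_of_ne hij with h | h
    · exact hx i j h hj
    · rw [adj_comm]; exact ⟨(hx j i h hi).1.symm, (hx j i h hi).2⟩

/-- At most the head of the path is adjacent to `v`, and a single neighbor spans no pair to be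
flipped. -/
theorem IsInducedPathList.localComplement {G : SimpleGraph V} {l : List V} {v : V}
    (h : G.IsInducedPathList l) (hv : ∀ u ∈ l.tail, ¬ G.Adj v u) :
    (G.localComplement v).IsInducedPathList l := by
  induction l with
  | nil => trivial
  | cons x l ih =>
    cases l with
    | nil => trivial
    | cons y l =>
      refine ⟨(localComplement_adj_of_not' (hv y (by simp))).2 h.1, fun u hu => ⟨?_, (h.2.1 u hu).2⟩,
        ih h.2.2 fun u hu => hv u (List.mem_of_mem_tail hu)⟩
      rw [localComplement_adj_of_not' (hv u (by simp [hu]))]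
      exact (h.2.1 u hu).1

theorem IsInducedPathList.cons {G : SimpleGraph V} {x z : V} {l : List V}
    (h : G.IsInducedPathList (z :: l)) (hxz : G.Adj x z)
    (hx : ∀ u ∈ l, x ≠ u ∧ ¬ G.Adj x u) : G.IsInducedPathList (x :: z :: l) :=
  ⟨hxz, fun u hu => ⟨(hx u hu).2, (hx u hu).1.symm⟩, h⟩

/-- Many vertices attached to the end of an induced path yield a broom. -/
theorem exists_hasBroom_of_many_neighbors (w : ℕ) : ∃ W, ∀ (V : Type u) (G : SimpleGraph V) (z : V)
    (l : List V) (x : ℕ → V), G.IsInducedPathList (z :: l) → (∀ i < W, G.Adj z (x i)) →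
    (∀ i < W, ∀ u ∈ l, x i ≠ u ∧ ¬ G.Adj (x i) u) → (∀ i j, i < j → j < W → x i ≠ x j) →
    ∃ G', G.LocallyEquivalent G' ∧ G'.HasBroom (l.length + 1) w 1 := by
  obtain ⟨W, hW⟩ := exists_homogeneous_subsequence Prop (w + 1)
  refine ⟨W, fun V G z l x hp hz hl hx => ?_⟩
  obtain ⟨g, hg, hgW, k, hk⟩ := hW fun i j => G.Adj (x i) (x j)
  simp only [eq_iff_iff] at hk
  by_cases hk' : k
  -- For a clique, complementing at `x (g 0)` makes the other `x (g i)` stable and detaches them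
  -- from `z`. They become leaves at the new center `x (g 0)`, and `z` joins the handle.
  · have h0 : ∀ u ∈ l, ¬ G.Adj (x (g 0)) u := fun u hu => (hl _ (hgW 0 (by omega)) u hu).2
    have hadj : ∀ i < w, G.Adj (x (g 0)) (x (g (i + 1))) := fun i hi =>
      (hk 0 (i + 1) (by omega) (by omega)).2 hk'
    refine ⟨G.localComplement (x (g 0)), locallyEquivalent_localComplement _ _,
      hasBroom_of_leaves (z := x (g 0)) (l := z :: l) (x := fun i => x (g (i + 1))) ?_ (by simp)
      (fun i hi => ?_) (fun i hi u hu => ?_) (fun i j hij hj => ?_)⟩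
    · refine (hp.localComplement h0).cons ?_ fun u hu => ⟨(hl _ (hgW 0 (by omega)) u hu).1, ?_⟩
      · rw [localComplement_adj_self]; exact (hz _ (hgW 0 (by omega))).symm
      · rw [localComplement_adj_self]; exact h0 u hu
    · rw [localComplement_adj_self]; exact hadj i hi
    · have hne : x (g (i + 1)) ≠ z := (hz _ (hgW _ (by omega))).ne'
      rcases List.mem_cons.1 hu with rfl | hu
      · refine ⟨hne, ?_⟩
        rw [localComplement_adj hne]
        simp [hadj i hi, (hz _ (hgW 0 (by omega))).symm, (hz _ (hgW (i + 1) (by omega))).symm]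
      · rw [localComplement_adj_of_not' (h0 u hu)]
        exact hl _ (hgW _ (by omega)) u hu
    · have hne := hx _ _ (hg (i + 1) (j + 1) (by omega) (by omega)) (hgW _ (by omega))
      refine ⟨hne, ?_⟩
      rw [localComplement_adj hne]
      simp [hadj i (by omega), hadj j hj, (hk (i + 1) (j + 1) (by omega) (by omega)).2 hk']
  · exact ⟨G, .refl G, hasBroom_of_leaves (x := fun i => x (g i)) hp le_rfl
      (fun i hi => hz _ (hgW i (by omega))) (fun i hi => hl _ (hgW i (by omega)))
      (fun i j hij hj => ⟨hx _ _ (hg i j hij (by omega)) (hgW j (by omega)),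
        fun h => hk' ((hk i j hij (by omega)).1 h)⟩)⟩

/-- Pivoting on `q` and `x 0` hands the neighbors of `q` to `x 0`, joins `q` to `z`, and cuts `z`
off from the other `x i`. The result is the path `x 0, q, z, l` with leaves at `x 0`. -/
theorem exists_hasBroom_of_common_neighbors {G : SimpleGraph V} {w : ℕ} {z q : V} {l : List V}
    {x : ℕ → V} (hp : G.IsInducedPathList (z :: l)) (hq : q ≠ z ∧ ∀ u ∈ l, q ≠ u ∧ ¬ G.Adj q u)
    (hzq : ¬ G.Adj z q) (hz : ∀ i < w + 1, G.Adj z (x i)) (hqx : ∀ i < w + 1, G.Adj q (x i))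
    (hl : ∀ i < w + 1, ∀ u ∈ l, x i ≠ u ∧ ¬ G.Adj (x i) u)
    (hx : ∀ i j, i < j → j < w + 1 → x i ≠ x j ∧ ¬ G.Adj (x i) (x j)) :
    ∃ G', G.LocallyEquivalent G' ∧ G'.HasBroom (l.length + 3) w 1 := by
  have h0 := hqx 0 (by omega)
  have h0z : x 0 ≠ z := (hz 0 (by omega)).ne'
  have hz0 : z ≠ x 0 := h0z.symm
  have hxl := hl 0 (by omega)
  have hlz := hp.head_ne
  -- pivoting on the edge between `q` and `x 0` is `*q * (x 0) *q`, none of which affects `l`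
  have e1 : ∀ u ∈ l, ∀ a, (G.localComplement q).Adj a u ↔ G.Adj a u := fun u hu a =>
    localComplement_adj_of_not' (hq.2 u hu).2
  have e2 : ∀ u ∈ l, ∀ a, ((G.localComplement q).localComplement (x 0)).Adj a u ↔ G.Adj a u :=
    fun u hu a => by
      rw [localComplement_adj_of_not' (by rw [e1 u hu]; exact (hxl u hu).2), e1 u hu]
  have e3 : ∀ u ∈ l, ∀ a, (G.pivot q (x 0)).Adj a u ↔ G.Adj a u := fun u hu a => by
    rw [pivot, localComplement_adj_of_not' (by rw [e2 u hu]; exact (hq.2 u hu).2), e2 u hu]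
  have hpath : (G.pivot q (x 0)).IsInducedPathList (z :: l) :=
    ((hp.localComplement (v := q) fun u hu => (hq.2 u hu).2).localComplement (v := x 0)
      fun u hu => by rw [e1 u hu]; exact (hxl u hu).2).localComplement (v := q)
      fun u hu => by rw [e2 u hu]; exact (hq.2 u hu).2
  have hx0 : ∀ i < w, x (i + 1) ≠ x 0 ∧ ¬ G.Adj (x 0) (x (i + 1)) := fun i hi =>
    ⟨(hx 0 (i + 1) (by omega) (by omega)).1.symm, (hx 0 (i + 1) (by omega) (by omega)).2⟩
  have hxq : ∀ i < w, x (i + 1) ≠ q := fun i hi => (hqx (i + 1) (by omega)).ne'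
  refine ⟨G.pivot q (x 0), locallyEquivalent_pivot _ _ _, hasBroom_of_leaves (z := x 0)
    (l := q :: z :: l) (x := fun i => x (i + 1)) ?_ (by simp) (fun i hi => ?_)
    (fun i hi u hu => ?_) (fun i j hij hj => ?_)⟩
  · refine (hpath.cons ?_ fun u hu => ⟨(hq.2 u hu).1, ?_⟩).cons (pivot_adj_pair h0).symm ?_
    · rw [pivot_adj_left h0 hq.1.symm hz0]; exact (hz 0 (by omega)).symm
    · rw [e3 u hu]; exact (hq.2 u hu).2
    · intro u hu
      rcases List.mem_cons.1 hu with rfl | hu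
      · refine ⟨h0z, ?_⟩
        rw [pivot_adj_right h0 hq.1.symm hz0, adj_comm]; exact hzq
      · rw [e3 u hu]; exact hxl u hu
  · rw [pivot_adj_right h0 (hxq i hi) (hx0 i hi).1]
    exact hqx (i + 1) (by omega)
  · rcases List.mem_cons.1 hu with rfl | hu
    · refine ⟨hxq i hi, ?_⟩
      rw [adj_comm, pivot_adj_left h0 (hxq i hi) (hx0 i hi).1]
      exact (hx0 i hi).2
    · rcases List.mem_cons.1 hu with rfl | hu
      · have hne := (hz (i + 1) (by omega)).ne'
        refine ⟨hne, ?_⟩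
        rw [pivot_adj h0 (hxq i hi) (hx0 i hi).1 hq.1.symm hz0 hne]
        simp [hqx (i + 1) (by omega), (hz (i + 1) (by omega)).symm, (hz 0 (by omega)).symm,
          (hx0 i hi).2]
      · rw [e3 u hu]; exact hl (i + 1) (by omega) u hu
  · have := hx (i + 1) (j + 1) (by omega) (by omega)
    refine ⟨this.1, ?_⟩
    rw [pivot_adj h0 (hxq i (by omega)) (hx0 i (by omega)).1 (hxq j hj) (hx0 j hj).1 this.1]
    simp [(hx0 i (by omega)).2, (hx0 j hj).2, this.2]

theorem HasBroom.of_le {G : SimpleGraph V} {h h' w ℓ : ℕ} (H : G.HasBroom h w ℓ) (hh : h' ≤ h) :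
    G.HasBroom h' w ℓ := by
  obtain ⟨z, l, F, H⟩ := H
  exact ⟨z, l, F, { H with length := hh.trans H.length }⟩

/-- Many common neighbors of the end `z` of an induced path and of a vertex `q` not attached to
the path elsewhere yield a broom with a longer handle. -/
theorem exists_hasBroom_of_homogeneous_common_neighbors {G : SimpleGraph V} {w : ℕ} {z q : V}
    {l : List V} {x : ℕ → V} {κ : Prop} (hp : G.IsInducedPathList (z :: l))
    (hq : q ≠ z ∧ ∀ u ∈ l, q ≠ u ∧ ¬ G.Adj q u)
    (hz : ∀ i < w + 2, G.Adj z (x i)) (hqx : ∀ i < w + 2, G.Adj q (x i))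
    (hl : ∀ i < w + 2, ∀ u ∈ l, x i ≠ u ∧ ¬ G.Adj (x i) u)
    (hx : ∀ i j, i < j → j < w + 2 → x i ≠ x j ∧ (G.Adj (x i) (x j) ↔ κ)) :
    ∃ G', G.LocallyEquivalent G' ∧ G'.HasBroom (l.length + 2) w 1 := by
  by_cases hκ : κ
  · have hql : ∀ u ∈ l, ¬ G.Adj q u := fun u hu => (hq.2 u hu).2
    have hG := locallyEquivalent_localComplement G q
    have hp' := hp.localComplement (v := q) hql
    have hl' : ∀ a, ∀ u ∈ l, (G.localComplement q).Adj a u ↔ G.Adj a u := fun a u hu =>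
      localComplement_adj_of_not' (hql u hu)
    have hxx : ∀ i j, i < j → j < w + 2 → x i ≠ x j ∧ ¬ (G.localComplement q).Adj (x i) (x j) :=
      fun i j hij hj => by
        have := hx i j hij hj
        refine ⟨this.1, ?_⟩
        rw [localComplement_adj this.1]
        simp [hqx i (by omega), hqx j hj, this.2, hκ]
    -- Complementing at `q` has made the `x i` stable. If `z` and `q` are adjacent, it has also cut
    -- `z` off from the `x i`, so `q` can serve directly as the new center.
    by_cases hzq : G.Adj z q
    · refine ⟨_, hG, hasBroom_of_leaves (z := q) (l := z :: l) (x := x) (hp'.cons ?_ ?_) (by simp)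
        (fun i hi => ?_) (fun i hi u hu => ?_) (fun i j hij hj => hxx i j hij (by omega))⟩
      · rw [localComplement_adj_self]; exact hzq.symm
      · exact fun u hu => by rw [hl' q u hu]; exact hq.2 u hu
      · rw [localComplement_adj_self]; exact hqx i (by omega)
      · rcases List.mem_cons.1 hu with rfl | hu
        · have hne := (hz i (by omega)).ne'
          refine ⟨hne, ?_⟩
          rw [localComplement_adj hne]
          simp [hqx i (by omega), hzq.symm, (hz i (by omega)).symm]
        · rw [hl' _ u hu]; exact hl i (by omega) u hu
    · have hqz : ¬ G.Adj q z := fun h => hzq h.symm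
      obtain ⟨G', hG', H⟩ := exists_hasBroom_of_common_neighbors (G := G.localComplement q) (w := w)
        (x := x) hp' ⟨hq.1, fun u hu => by rw [hl' q u hu]; exact hq.2 u hu⟩
        (by rwa [localComplement_adj_self'])
        (fun i hi => by rw [localComplement_adj_of_not hqz]; exact hz i (by omega))
        (fun i hi => by rw [localComplement_adj_self]; exact hqx i (by omega))
        (fun i hi u hu => by rw [hl' _ u hu]; exact hl i (by omega) u hu)
        (fun i j hij hj => hxx i j hij (by omega))
      exact ⟨G', hG.trans hG', H.of_le (by omega)⟩
  · by_cases hzq : G.Adj z q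
    -- Complementing at the common neighbor `x 0` deletes the edge `zq` and leaves the other `x i`
    -- unchanged, at the cost of one of them.
    · have h0l : ∀ u ∈ l, ¬ G.Adj (x 0) u := fun u hu => (hl 0 (by omega) u hu).2
      have h0x : ∀ i < w + 1, ∀ a, (G.localComplement (x 0)).Adj a (x (i + 1)) ↔
          G.Adj a (x (i + 1)) := fun i hi a => localComplement_adj_of_not' fun h =>
        hκ ((hx 0 (i + 1) (by omega) (by omega)).2.1 h)
      have hG := locallyEquivalent_localComplement G (x 0)
      obtain ⟨G', hG', H⟩ := exists_hasBroom_of_common_neighbors (G := G.localComplement (x 0))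
        (w := w) (x := fun i => x (i + 1)) (q := q) (hp.localComplement h0l)
        ⟨hq.1, fun u hu => by rw [localComplement_adj_of_not' (h0l u hu)]; exact hq.2 u hu⟩
        (by
          rw [localComplement_adj hq.1.symm]
          simp [hzq, (hz 0 (by omega)).symm, (hqx 0 (by omega)).symm])
        (fun i hi => (h0x i hi z).2 (hz _ (by omega)))
        (fun i hi => (h0x i hi q).2 (hqx _ (by omega)))
        (fun i hi u hu => by
          rw [localComplement_adj_of_not' (h0l u hu)]; exact hl (i + 1) (by omega) u hu)
        (fun i j hij hj => by
          rw [h0x j hj]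
          have := hx (i + 1) (j + 1) (by omega) (by omega)
          exact ⟨this.1, fun h => hκ (this.2.1 h)⟩)
      exact ⟨G', hG.trans hG', H.of_le (by omega)⟩
    · obtain ⟨G', hG', H⟩ := exists_hasBroom_of_common_neighbors (w := w) (x := x) hp hq hzq
        (fun i hi => hz i (by omega)) (fun i hi => hqx i (by omega)) (fun i hi => hl i (by omega))
        (fun i j hij hj => ⟨(hx i j hij (by omega)).1,
          fun h => hκ ((hx i j hij (by omega)).2.1 h)⟩)
      exact ⟨G', hG', H.of_le (by omega)⟩

theorem _root_.Set.exists_injective_seq {S : Set V} [Nonempty V] {M : ℕ} (h : M ≤ S.ncard) :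
    ∃ x : ℕ → V, (∀ i < M, x i ∈ S) ∧ ∀ i j, i < j → j < M → x i ≠ x j := by
  classical
  rcases Nat.eq_zero_or_pos M with rfl | hM
  · exact ⟨fun _ => Classical.arbitrary V, by simp, by simp⟩
  have hfin : S.Finite := Set.finite_of_ncard_pos (by omega)
  have := hfin.fintype
  let e := Fintype.equivFin S
  have hc : M ≤ Fintype.card S := by
    rwa [← Nat.card_eq_fintype_card, Nat.card_coe_set_eq]
  refine ⟨fun i => if h : i < M then (e.symm ⟨i, h.trans_le hc⟩ : V) else Classical.arbitrary V,
    fun i hi => ?_, fun i j hij hj => ?_⟩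
  · simp only [hi, dite_true]; exact Subtype.coe_prop _
  · simp only [hj, hij.trans hj, dite_true]
    intro he
    have := e.symm.injective (Subtype.ext he)
    simp at this; omega

/-- A single large fiber yields a broom with a longer handle. -/
theorem exists_longer_handle (c w : ℕ) : ∃ L, ∀ (V : Type u) [Finite V] (G : SimpleGraph V),
    G.AvoidsPathAndMatchedCliques c → ∀ h ℓ, L ≤ ℓ → G.HasBroom h 1 ℓ →
    ∃ G', G.LocallyEquivalent G' ∧ G'.HasBroom (h + 1) w 1 := by
  classical
  obtain ⟨M₁, hM₁⟩ := exists_hasBroom_of_many_neighbors.{u} w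
  obtain ⟨M₂, hM₂⟩ := exists_subsequence_of_finite (Fin c) M₁
  obtain ⟨M₃, hM₃⟩ := exists_homogeneous_subsequence (Prop × Prop) (M₂ + w + 3)
  obtain ⟨L, hL⟩ := exists_large_neighborSet.{u} c M₃
  refine ⟨L, fun V _ G hG h ℓ hℓ ⟨z, l, F, H⟩ => ?_⟩
  have : Nonempty V := ⟨z⟩
  have hlen := H.length
  have hdF := H.tail 0 (by omega)
  have hzF := H.notMem 0 (by omega)
  obtain ⟨q, hqF, hq⟩ := hL V G hG (F 0) (H.conn 0 (by omega)) (by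
    rw [H.card 0 (by omega)]; exact hℓ)
  obtain ⟨b, hb, hbb⟩ := Set.exists_injective_seq hq
  obtain ⟨g, hg, hgM, ⟨k1, k2⟩, hk⟩ := hM₃ fun i j => (G.Adj z (b i), G.Adj (b i) (b j))
  simp only [Prod.mk.injEq, eq_iff_iff] at hk
  have hbF : ∀ i < M₂ + w + 3, b (g i) ∈ F 0 := fun i hi => (hb _ (hgM i hi)).2
  have hqb : ∀ i < M₂ + w + 3, G.Adj q (b (g i)) := fun i hi => (hb _ (hgM i hi)).1
  have hzb : ∀ i < M₂ + w + 2, G.Adj z (b (g i)) ↔ k1 := fun i hi =>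
    (hk i (i + 1) (by omega) (by omega)).1
  by_cases h1 : k1
  · obtain ⟨G', hG', H'⟩ := exists_hasBroom_of_homogeneous_common_neighbors (w := w) (q := q)
      (x := fun i => b (g i)) (κ := k2) H.path
      ⟨fun h => hzF (h ▸ hqF), hdF q hqF⟩
      (fun i hi => (hzb i (by omega)).2 h1) (fun i hi => hqb i (by omega))
      (fun i hi => hdF _ (hbF i (by omega)))
      (fun i j hij hj => ⟨hbb _ _ (hg i j hij (by omega)) (hgM j (by omega)),
        (hk i j hij (by omega)).2⟩)
    exact ⟨G', hG', H'.of_le (by omega)⟩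
  -- Now `z` misses all the `b (g i)`. The handle is prolonged along a shortest path from the
  -- neighbors of `z` to `q`, up to the first vertex `s k` that sees `b (g i)`; by pigeonhole the
  -- same `k` serves many `i`.
  · obtain ⟨n, s, hsF, hs0, hsn, hsA, -, hs, -⟩ := (H.conn 0 (by omega)).exists_isInducedPathSeq
      (A := {a | a ∈ F 0 ∧ G.Adj z a}) (B := {q}) (fun a ha => ha.1)
      (by simpa using hqF) (H.adj 0 (by omega)) ⟨q, rfl⟩
    have hnc := hs.lt hG
    have hf : ∀ i, ∃ k : Fin c, i < M₂ → k.1 ≤ n ∧ G.Adj (s k) (b (g i)) ∧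
        ∀ k' < k.1, ¬ G.Adj (s k') (b (g i)) := fun i => by
      by_cases hi : i < M₂
      · have hex : ∃ k, G.Adj (s k) (b (g i)) := ⟨n, by
          rw [show s n = q from hsn]; exact hqb i (by omega)⟩
        have hle : Nat.find hex ≤ n := Nat.find_min' hex (by
          rw [show s n = q from hsn]; exact hqb i (by omega))
        exact ⟨⟨Nat.find hex, by omega⟩, fun _ => ⟨hle, Nat.find_spec hex,
          fun k' hk' => Nat.find_min hex hk'⟩⟩
      · exact ⟨⟨0, by omega⟩, fun h => (hi h).elim⟩
    choose f hf using hf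
    obtain ⟨g', hg', hgM', k, hk'⟩ := hM₂ f
    -- The bound `k ≤ n` is read off from some `b (g i)`. If none is required, prolonging the handle
    -- by `s 0` is enough.
    rcases Nat.eq_zero_or_pos M₁ with h0 | hpos
    · obtain ⟨G', hG', H'⟩ := hM₁ V G (s 0) (prependRev s 0 (z :: l)).tail s (by
        have := (hs.mono (Nat.zero_le n)).cons_prependRev H.path
          (fun i hi => ⟨fun h => hzF (h ▸ hsF i (by omega)), by
            obtain rfl : i = 0 := by omega
            simpa using hs0.2.symm⟩)
          (fun i hi u hu => hdF _ (hsF i (by omega)) u hu)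
        simpa [prependRev] using this) (by omega) (by omega) (by omega)
      exact ⟨G', hG', H'.of_le (by simp [prependRev]; omega)⟩
    have hkn : k.1 ≤ n := by
      have := (hf (g' 0) (hgM' 0 hpos)).1
      rwa [hk' 0 hpos] at this
    have hpath := (hs.mono hkn).cons_prependRev H.path
      (fun i hi => ⟨fun h => hzF (h ▸ hsF i (by omega)), fun h => hsA i (by omega)
        ⟨hsF i (by omega), h.symm⟩, fun h => by rw [h]; exact hs0.2.symm⟩)
      (fun i hi u hu => hdF _ (hsF i (by omega)) u hu)
    obtain ⟨t, ht, htm⟩ := prependRev_eq_cons s k (z :: l)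
    have hlent : t.length = k + 1 + l.length := by
      have := length_prependRev s k (z :: l)
      rw [ht] at this
      simp at this; omega
    rw [ht] at hpath
    have hfk : ∀ i < M₁, G.Adj (s k) (b (g (g' i))) ∧ ∀ k' < k.1, ¬ G.Adj (s k') (b (g (g' i))) :=
      fun i hi => by
        have := (hf (g' i) (hgM' i hi)).2
        rwa [hk' i hi] at this
    have htl : ∀ i < M₁, ∀ u ∈ t, b (g (g' i)) ≠ u ∧ ¬ G.Adj (b (g (g' i))) u := by
      intro i hi u hu
      have hiM := hgM' i hi
      have hbi := hbF (g' i) (by omega)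
      have hzbi : ¬ G.Adj z (b (g (g' i))) := fun h => h1 ((hzb _ (by omega)).1 h)
      rcases (htm u).1 hu with hu | ⟨m, hm, rfl⟩
      · rcases List.mem_cons.1 hu with rfl | hu
        · exact ⟨fun h => hzF (h ▸ hbi), fun h => hzbi h.symm⟩
        · exact hdF _ hbi u hu
      -- A `b (g i)` equal to `s m` with `m < k` would be adjacent to `z` when `m = 0`, and to the
      -- earlier path vertex `s (m - 1)` otherwise.
      · refine ⟨fun h => ?_, fun h => (hfk i hi).2 m hm h.symm⟩
        rcases m with _ | m
        · exact hzbi (h ▸ hs0.2)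
        · refine (hfk i hi).2 m (by omega) ?_
          rw [h]
          exact (hs m (m + 1) (by omega) (by omega)).2.2 rfl
    obtain ⟨G', hG', H'⟩ := hM₁ V G (s k) t (fun i => b (g (g' i))) hpath
      (fun i hi => (hfk i hi).1) htl
      (fun i j hij hj => hbb _ _ (hg _ _ (hg' i j hij hj) (by have := hgM' j hj; omega))
        (hgM _ (by have := hgM' j hj; omega)))
    exact ⟨G', hG', H'.of_le (by omega)⟩

/-! ### The induction on the handle and the conclusion -/

/-- A set with no edges leaving it gives a split with empty `A₀` and `B₀`, provided that both sides
have two vertices; excluding isolated vertices ensures this. -/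
theorem IsSplitPrime.connectedOn_univ [Finite V] {G : SimpleGraph V} (hG : G.IsSplitPrime)
    (hV : 4 ≤ Nat.card V) : G.ConnectedOn Set.univ := by
  classical
  have hnt : ∀ S : Set V, 2 ≤ S.ncard → S.Nontrivial := fun S hS =>
    Set.one_lt_ncard_iff_nontrivial.1 (by omega)
  have hcard : ∀ S : Set V, S.ncard + Sᶜ.ncard = Nat.card V := fun S => Set.ncard_add_ncard_compl S
  -- an isolated vertex together with any other vertex forms one side of a split
  have hiso : ∀ a, ∃ b, G.Adj a b := by
    intro a
    by_contra! hcon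
    have : Nontrivial V := Finite.one_lt_card_iff_nontrivial.1 (by omega)
    obtain ⟨b, hb⟩ := exists_ne a
    have h2 : ({a, b} : Set V).ncard = 2 := Set.ncard_pair hb.symm
    have := hcard {a, b}
    refine hG {a, b} {a, b}ᶜ ⟨disjoint_compl_right, Set.union_compl_self _, hnt _ (by omega),
      hnt _ (by omega), {b}, by simp, {v | v ∈ ({a, b} : Set V)ᶜ ∧ G.Adj b v}, fun v hv => hv.1, ?_⟩
    rintro x (rfl | rfl) y hy
    · exact iff_of_false (hcon y) fun h => hb h.1.symm
    · exact ⟨fun h => ⟨rfl, hy, h⟩, fun h => h.2.2⟩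
  intro X _ hX hX'
  by_contra! hcon
  have hno : ∀ x ∈ X, ∀ y ∉ X, ¬ G.Adj x y := fun x hx y hy => hcon x hx y trivial hy
  have h1 : X.Nontrivial := by
    obtain ⟨a, ha⟩ := hX
    obtain ⟨b, hab⟩ := hiso a
    exact ⟨a, ha, b, by_contra fun hb => hno a ha b hb hab, hab.ne⟩
  have h2 : Xᶜ.Nontrivial := by
    obtain ⟨a, ha⟩ := Set.nonempty_compl.2 hX'
    obtain ⟨b, hab⟩ := hiso a
    exact ⟨a, ha, b, fun hb => hno b hb a ha hab.symm, hab.ne⟩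
  exact hG X Xᶜ ⟨disjoint_compl_right, Set.union_compl_self _, h1, h2, ∅, Set.empty_subset _, ∅,
    Set.empty_subset _, fun x hx y hy => iff_of_false (hno x hx y hy) fun h => h.1⟩

/-- The induction is over all widths at once: the next handle vertex needs one fiber of more than
`L` vertices, growing it needs width `W`, and the broom provided by induction must be that wide. -/
theorem exists_hasBroom (c h w : ℕ) : ∃ N, ∀ (V : Type u) [Finite V] (G : SimpleGraph V),
    G.IsSplitPrime → G.AvoidsPathAndMatchedCliques c → N ≤ Nat.card V →
    ∃ G', G.LocallyEquivalent G' ∧ G'.HasBroom (h + 1) w 1 := by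
  induction h generalizing w with
  | zero =>
    obtain ⟨M, hM⟩ := exists_hasBroom_of_many_neighbors.{u} w
    obtain ⟨N, hN⟩ := exists_large_neighborSet.{u} c M
    refine ⟨N + 4, fun V _ G hp hG hV => ?_⟩
    obtain ⟨q, -, hq⟩ := hN V G hG Set.univ (hp.connectedOn_univ (by omega))
      (by rw [Set.ncard_univ]; omega)
    have : Nonempty V := ⟨q⟩
    obtain ⟨x, hx, hxx⟩ := Set.exists_injective_seq hq
    exact hM V G q [] x trivial (fun i hi => (hx i hi).1) (by simp) hxx
  | succ h ih =>
    obtain ⟨L, hL⟩ := exists_longer_handle.{u} c w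
    obtain ⟨W, hW⟩ := exists_fibers_card_eq.{u} c 1 L
    obtain ⟨N, hN⟩ := ih W
    refine ⟨N, fun V _ G hp hG hV => ?_⟩
    obtain ⟨G₁, hG₁, H₁⟩ := hN V G hp hG hV
    have hG' := hG.of_locallyEquivalent hG₁
    obtain ⟨G₂, hG₂, H₂⟩ := hW V G₁ (hp.of_locallyEquivalent hG₁) hG' _ H₁
    obtain ⟨G₃, hG₃, H₃⟩ := hL V G₂ (hG'.of_locallyEquivalent hG₂) _ _ (by omega) H₂
    exact ⟨G₃, (hG₁.trans hG₂).trans hG₃, H₃⟩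

end SimpleGraph

theorem mainTheorem3 (c : ℕ) :
    ∃ N : ℕ, ∀ (V : Type*) [Finite V] (G : SimpleGraph V),
      G.IsSplitPrime → N ≤ Nat.card V →
        G.HasVertexMinorIso (SimpleGraph.pathGraph c) ∨
        G.HasVertexMinorIso
          (SimpleGraph.matchingJoin (⊤ : SimpleGraph (Fin c)) (⊤ : SimpleGraph (Fin c))) := by
  -- A handle of `c + 1` vertices is already too long, so no fibers are needed.
  obtain ⟨N, hN⟩ := SimpleGraph.exists_hasBroom c c 0
  refine ⟨N, fun V _ G hp hV => ?_⟩
  by_contra! hcon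
  have hG : G.AvoidsPathAndMatchedCliques c := hcon
  obtain ⟨G', hG', z, l, F, H⟩ := hN V G hp hG hV
  have h1 := H.path.length_lt (hG.of_locallyEquivalent hG')
  have h2 := H.length
  simp at h1
  omega
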